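/- Let $k$ be a field, $G$ a group and $\mathcal C$ a small $k$-linear category on which $G$ acts by $k$-linear automorphisms, freely on the set of objects $\mathcal C_0$. Let $\mathcal C\to\mathcal C/G$ be the corresponding Galois covering: the objects of $\mathcal C/G$ are the orbits of $\mathcal C_0$, its morphisms from $\alpha$ to $\beta$ are the coinvariants $\bigl(\bigoplus_{x\in\alpha,\,y\in\beta}\mathcal C(x,y)\bigr)_G$, and the composite of the classes of $f\colon x\to y$ and $g\colon y'\to z$, with $y,y'\in\beta$, is the class of $g\circ sf$, where $s\in G$ is the unique element with $sy=y'$. Fix a transversal $T\subset\mathcal C_0$ (one object $u_\alpha$ in each orbit $\alpha$) and grade $\mathcal C/G$ by $G$ through it: the morphisms of degree $s$ from $\alpha$ to $\beta$ are the classes of the morphisms $su_\alpha\to u_\beta$ of $\mathcal C$, and the degree of $g\circ f$ is the product $\deg g\cdot\deg f$. For a $k$-category $\mathcal B$ let $C^\bullet(\mathcal B)$, with $C^n(\mathcal B)=\prod_{x_1,\dots,x_{n+1}}\mathrm{Hom}_k\bigl(\mathcal B(x_n,x_{n+1})\otimes\cdots\otimes\mathcal B(x_1,x_2),\ \mathcal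 B(x_1,x_{n+1})\bigr)$ (and $C^0(\mathcal B)=\prod_x\mathcal B(x,x)$), be the differential graded algebra of Hochschild–Mitchell cochains, with the Hochschild coboundary and the cup product $(\psi\smile\varphi)(f_{n+m},\dots,f_1)=\psi(f_{n+m},\dots,f_{n+1})\,\varphi(f_n,\dots,f_1)$; its cohomology is $HH^*(\mathcal B)$. Let $HH^*_{\{1\}}(\mathcal C/G)$ be the cohomology of the differential graded subalgebra of $C^\bullet(\mathcal C/G)$ that belongs to the trivial conjugacy class of $G$, i.e. of the cochains $\varphi$ such that $\varphi(f_n,\dots,f_1)$ is of degree $s_n\cdots s_1$ whenever each $f_i$ is homogeneous of degree $s_i$. The group $G$ acts on $C^\bullet(\mathcal C)$ by $(s\varphi)(f_n,\dots,f_1)=s\,\varphi(s^{-1}f_n,\dots,s^{-1}f_1)$, and hence on $HH^*(\mathcal C)$. Then there is an isomorphism of graded $k$-algebras $$HH^*_{\{1\}}(\mathcal C/G)\;\simeq\;H^*\bigl(C^\bullet(\mathcal C)^G\bigr).$$ If the invariants functor $M\mapsto M^G$ from $k$-linear representations of $G$ to $k$-vector spaces is exact, then there is an isomorphism of graded $k$-algebras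 $$HH^*_{\{1\}}(\mathcal C/G)\;\simeq\;HH^*(\mathcal C)^G.$$ -/

import Mathlib

open CategoryTheory

set_option linter.unusedSectionVars false

universe u v w u₁

namespace HochschildMitchell

noncomputable section

section Cochains

variable (k : Type u) [Field k] (B : Type w) [Category.{v} B] [Preadditive B] [Linear k B]

/-- Hochschild-Mitchell cochains of degree `n` of the `k`-category `B`: families, indexed by the
sequences of objects `x 0, …, x n`, of `k`-linear maps from the tensor product of the spaces
`x i ⟶ x (i + 1)` to `x 0 ⟶ x n`; a linear map on a tensor product is given as a multilinear map.
For `n = 0` such a family is an element of the product over `x` of the spaces `x ⟶ x`. -/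
abbrev Cochain (n : ℕ) : Type (max v w) :=
  ∀ x : Fin (n + 1) → B,
    MultilinearMap k (fun i : Fin n => (x i.castSucc ⟶ x i.succ)) (x 0 ⟶ x (Fin.last n))

variable {k B}

section Edge

variable {B : Type w} [Category.{v} B] {n : ℕ} (x : Fin (n + 1) → B)
  (f : ∀ i : Fin n, x i.castSucc ⟶ x i.succ)

/-- In a sequence `f` of composable morphisms `x 0 ⟶ x 1 ⟶ … ⟶ x n`, the composite from `x a` to
`x b`; it is the identity for `a = b`. -/
def edge {a b : Fin (n + 1)} (hab : a ≤ b) : x a ⟶ x b :=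
  (ComposableArrows.mkOfObjOfMapSucc x f).map (homOfLE hab)

theorem edge_succ (i : Fin n) : edge x f i.castSucc_le_succ = f i :=
  ComposableArrows.mkOfObjOfMapSucc_map_succ x f i.1 i.2

theorem edge_self {a : Fin (n + 1)} (h : a ≤ a) : edge x f h = 𝟙 (x a) :=
  (ComposableArrows.mkOfObjOfMapSucc x f).map_id a

theorem edge_comp {a b c : Fin (n + 1)} (hab : a ≤ b) (hbc : b ≤ c) :
    edge x f hab ≫ edge x f hbc = edge x f (hab.trans hbc) :=
  ((ComposableArrows.mkOfObjOfMapSucc x f).map_comp (homOfLE hab) (homOfLE hbc)).symm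

/-- `edge` is characterized by its behaviour on identities, composites and successive vertices. -/
theorem edge_unique (e : ∀ a b : Fin (n + 1), a ≤ b → (x a ⟶ x b))
    (h1 : ∀ a, e a a le_rfl = 𝟙 _)
    (hc : ∀ a (j : Fin n) (h : a ≤ j.castSucc),
      e a j.succ (h.trans j.castSucc_le_succ) = e a j.castSucc h ≫ e _ _ j.castSucc_le_succ)
    {a b : Fin (n + 1)} (hab : a ≤ b)
    (H : ∀ i : Fin n, a ≤ i.castSucc → i.succ ≤ b → e _ _ i.castSucc_le_succ = f i) :
    edge x f hab = e a b hab := by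
  induction b using Fin.induction with
  | zero =>
    obtain rfl : a = 0 := le_antisymm hab (Fin.zero_le _)
    rw [edge_self, h1]
  | succ j ih =>
    rcases hab.lt_or_eq with hlt | heq
    · have haj : a ≤ j.castSucc := Fin.le_castSucc_iff.2 hlt
      rw [hc a j haj, ← edge_comp x f haj j.castSucc_le_succ, edge_succ, H j haj le_rfl,
        ih haj fun i h1 h2 => H i h1 (h2.trans j.castSucc_le_succ)]
    · subst heq
      rw [edge_self, h1]

theorem edge_congr {f f' : ∀ i : Fin n, x i.castSucc ⟶ x i.succ} {a b : Fin (n + 1)} (hab : a ≤ b)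
    (H : ∀ i : Fin n, a ≤ i.castSucc → i.succ ≤ b → f i = f' i) :
    edge x f hab = edge x f' hab := by
  refine edge_unique x f (fun _ _ h => edge x f' h) (fun _ => edge_self x f' _)
    (fun _ _ _ => (edge_comp x f' _ _).symm) hab fun i h1 h2 => ?_
  rw [H i h1 h2, edge_succ]

theorem edge_edge {m : ℕ} (σ : Fin (m + 1) →o Fin (n + 1)) {a b : Fin (m + 1)} (hab : a ≤ b) :
    edge (fun i => x (σ i)) (fun i => edge x f (σ.monotone i.castSucc_le_succ)) hab =
      edge x f (σ.monotone hab) :=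
  edge_unique (fun i => x (σ i)) _ (fun _ _ h => edge x f (σ.monotone h))
    (fun _ => edge_self x f _) (fun _ _ _ => (edge_comp x f _ _).symm) hab fun _ _ _ => rfl

theorem edge_update_of_not [DecidableEq (Fin n)] {a b : Fin (n + 1)} (hab : a ≤ b) (j : Fin n)
    (v : x j.castSucc ⟶ x j.succ) (h : j.succ ≤ a ∨ b ≤ j.castSucc) :
    edge x (Function.update f j v) hab = edge x f hab := by
  refine edge_congr x hab fun i h1 h2 => Function.update_of_ne ?_ _ _
  rintro rfl
  rcases h with h | h
  · exact absurd (h.trans h1) (by simp)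
  · exact absurd (h2.trans h) (by simp)

theorem edge_update_of_mem [DecidableEq (Fin n)] {a b : Fin (n + 1)} (hab : a ≤ b) (j : Fin n)
    (v : x j.castSucc ⟶ x j.succ) (h1 : a ≤ j.castSucc) (h2 : j.succ ≤ b) :
    edge x (Function.update f j v) hab = edge x f h1 ≫ v ≫ edge x f h2 := by
  rw [← edge_comp x _ h1 (j.castSucc_le_succ.trans h2), ← edge_comp x _ j.castSucc_le_succ h2,
    edge_update_of_not x f _ j v (Or.inr le_rfl), edge_update_of_not x f _ j v (Or.inl le_rfl),
    edge_succ, Function.update_self]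

end Edge

/-- The cochain `φ` evaluated along the vertices `σ 0 ≤ … ≤ σ n` of a sequence `f` of composable
morphisms, extended by composition to a morphism from `x a` to `x b`, for `a ≤ σ 0`, `σ n ≤ b`. -/
def Cochain.eval {n N : ℕ} (φ : Cochain k B n) (x : Fin (N + 1) → B)
    (f : ∀ i : Fin N, x i.castSucc ⟶ x i.succ) (σ : Fin (n + 1) →o Fin (N + 1))
    (a b : Fin (N + 1)) (ha : a ≤ σ 0) (hb : σ (Fin.last n) ≤ b) : x a ⟶ x b :=
  edge x f ha ≫
    φ (fun i => x (σ i)) (fun i => edge x f (σ.monotone i.castSucc_le_succ)) ≫ edge x f hb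

section Multilinear

variable {n N : ℕ} (φ : Cochain k B n) (x : Fin (N + 1) → B)
  (f : ∀ i : Fin N, x i.castSucc ⟶ x i.succ)
  (σ : Fin (n + 1) →o Fin (N + 1)) {a b : Fin (N + 1)} (ha : a ≤ σ 0) (hb : σ (Fin.last n) ≤ b)

theorem eval_update_of_not [DecidableEq (Fin N)] (j : Fin N) (v : x j.castSucc ⟶ x j.succ)
    (h : j.succ ≤ a ∨ b ≤ j.castSucc) :
    φ.eval x (Function.update f j v) σ a b ha hb = φ.eval x f σ a b ha hb := by
  have hl : ∀ i, a ≤ σ i := fun i => ha.trans (σ.monotone (Fin.zero_le _))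
  have hr : ∀ i, σ i ≤ b := fun i => (σ.monotone (Fin.le_last _)).trans hb
  have H : ∀ {c d : Fin (N + 1)} (hcd : c ≤ d), a ≤ c → d ≤ b →
      edge x (Function.update f j v) hcd = edge x f hcd :=
    fun hcd h1 h2 => edge_update_of_not x f hcd j v
      (h.imp (fun h => h.trans h1) (fun h => h2.trans h))
  unfold Cochain.eval
  rw [H ha le_rfl (hr _), H hb (hl _) le_rfl]
  congr 3
  funext i
  exact H _ (hl _) (hr _)

/-- Every morphism between `x a` and `x b` enters exactly once into `eval`. -/
theorem eval_update_of_mem [DecidableEq (Fin N)] (j : Fin N)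
    (h1 : a ≤ j.castSucc) (h2 : j.succ ≤ b) :
    ∃ L : (x j.castSucc ⟶ x j.succ) →ₗ[k] (x a ⟶ x b), ∀ v,
      φ.eval x (Function.update f j v) σ a b ha hb = L v := by
  by_cases c0 : j.succ ≤ σ 0
  · refine ⟨Linear.rightComp k _ (edge x f c0 ≫
        φ (fun i => x (σ i)) (fun i => edge x f (σ.monotone i.castSucc_le_succ)) ≫
        edge x f hb) ∘ₗ Linear.leftComp k _ (edge x f h1), fun v => ?_⟩
    have hl : ∀ i, j.succ ≤ σ i := fun i => c0.trans (σ.monotone (Fin.zero_le _))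
    unfold Cochain.eval
    rw [edge_update_of_mem x f ha j v h1 c0, edge_update_of_not x f hb j v (Or.inl (hl _))]
    have : (fun i : Fin n => edge x (Function.update f j v) (σ.monotone i.castSucc_le_succ)) =
        fun i => edge x f (σ.monotone i.castSucc_le_succ) := by
      funext i
      exact edge_update_of_not x f _ j v (Or.inl (hl _))
    rw [this]
    simp only [LinearMap.comp_apply, Linear.leftComp_apply, Linear.rightComp_apply,
      Category.assoc]
  by_cases c1 : σ (Fin.last n) ≤ j.castSucc
  · refine ⟨Linear.leftComp k _ (edge x f ha ≫
        φ (fun i => x (σ i)) (fun i => edge x f (σ.monotone i.castSucc_le_succ)) ≫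
        edge x f c1) ∘ₗ Linear.rightComp k _ (edge x f h2), fun v => ?_⟩
    have hr : ∀ i, σ i ≤ j.castSucc := fun i => (σ.monotone (Fin.le_last _)).trans c1
    unfold Cochain.eval
    rw [edge_update_of_mem x f hb j v c1 h2, edge_update_of_not x f ha j v (Or.inr (hr _))]
    have : (fun i : Fin n => edge x (Function.update f j v) (σ.monotone i.castSucc_le_succ)) =
        fun i => edge x f (σ.monotone i.castSucc_le_succ) := by
      funext i
      exact edge_update_of_not x f _ j v (Or.inr (hr _))
    rw [this]
    simp only [LinearMap.comp_apply, Linear.leftComp_apply, Linear.rightComp_apply,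
      Category.assoc]
  · have c0' : σ 0 ≤ j.castSucc := Fin.le_castSucc_iff.2 (not_le.1 c0)
    have c1' : j.succ ≤ σ (Fin.last n) := by
      by_contra h
      exact c1 (Fin.le_castSucc_iff.2 (not_le.1 h))
    obtain ⟨i, hi1, hi2⟩ : ∃ i : Fin n, σ i.castSucc ≤ j.castSucc ∧ j.succ ≤ σ i.succ := by
      by_contra! hcon
      have : ∀ i : Fin (n + 1), σ i ≤ j.castSucc := by
        intro i
        induction i using Fin.induction with
        | zero => exact c0'
        | succ i ih => exact Fin.le_castSucc_iff.2 (hcon i ih)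
      exact c1 (this _)
    let g : ∀ i : Fin n, x (σ i.castSucc) ⟶ x (σ i.succ) :=
      fun i => edge x f (σ.monotone i.castSucc_le_succ)
    refine ⟨Linear.leftComp k _ (edge x f ha) ∘ₗ Linear.rightComp k _ (edge x f hb) ∘ₗ
      (φ (fun i => x (σ i))).toLinearMap g i ∘ₗ
      Linear.leftComp k _ (edge x f hi1) ∘ₗ Linear.rightComp k _ (edge x f hi2), fun v => ?_⟩
    unfold Cochain.eval
    rw [edge_update_of_not x f ha j v (Or.inr c0'), edge_update_of_not x f hb j v (Or.inl c1')]
    have : (fun i : Fin n => edge x (Function.update f j v) (σ.monotone i.castSucc_le_succ)) =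
        Function.update g i (edge x f hi1 ≫ v ≫ edge x f hi2) := by
      funext l
      by_cases hl : l = i
      · subst hl
        rw [Function.update_self]
        exact edge_update_of_mem x f _ j v hi1 hi2
      · rw [Function.update_of_ne hl]
        refine edge_update_of_not x f _ j v ?_
        rcases lt_or_gt_of_ne hl with h | h
        · right
          refine le_trans (σ.monotone ?_) hi1
          rw [Fin.le_def]
          simpa using h
        · left
          refine hi2.trans (σ.monotone ?_)
          rw [Fin.le_def]
          simpa using h
    rw [this]
    rfl

/-- The values of `φ.eval` along a sequence of morphisms, as a multilinear map. -/
def Cochain.evalMultilinear (ha : 0 ≤ σ 0) (hb : σ (Fin.last n) ≤ Fin.last N) :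
    MultilinearMap k (fun i : Fin N => (x i.castSucc ⟶ x i.succ)) (x 0 ⟶ x (Fin.last N)) where
  toFun f := φ.eval x f σ 0 (Fin.last N) ha hb
  map_update_add' f j v v' := by
    obtain ⟨L, hL⟩ := eval_update_of_mem φ x f σ ha hb j (Fin.zero_le _) (Fin.le_last _)
    rw [hL, hL, hL, map_add]
  map_update_smul' f j c v := by
    obtain ⟨L, hL⟩ := eval_update_of_mem φ x f σ ha hb j (Fin.zero_le _) (Fin.le_last _)
    rw [hL, hL, map_smul]

end Multilinear

theorem eval_add {n N : ℕ} (φ ψ : Cochain k B n) (x : Fin (N + 1) → B)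
    (f : ∀ i : Fin N, x i.castSucc ⟶ x i.succ) (σ : Fin (n + 1) →o Fin (N + 1))
    (a b : Fin (N + 1)) (ha : a ≤ σ 0) (hb : σ (Fin.last n) ≤ b) :
    (φ + ψ).eval x f σ a b ha hb = φ.eval x f σ a b ha hb + ψ.eval x f σ a b ha hb := by
  simp [Cochain.eval]

theorem eval_smul {n N : ℕ} (c : k) (φ : Cochain k B n) (x : Fin (N + 1) → B)
    (f : ∀ i : Fin N, x i.castSucc ⟶ x i.succ) (σ : Fin (n + 1) →o Fin (N + 1))
    (a b : Fin (N + 1)) (ha : a ≤ σ 0) (hb : σ (Fin.last n) ≤ b) :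
    (c • φ).eval x f σ a b ha hb = c • φ.eval x f σ a b ha hb := by
  simp [Cochain.eval]

theorem eval_congr {n N : ℕ} (φ : Cochain k B n) (x : Fin (N + 1) → B)
    (f : ∀ i : Fin N, x i.castSucc ⟶ x i.succ) {σ τ : Fin (n + 1) →o Fin (N + 1)}
    (h : ∀ i, σ i = τ i) (a b : Fin (N + 1)) (ha : a ≤ σ 0) (hb : σ (Fin.last n) ≤ b) :
    φ.eval x f σ a b ha hb = φ.eval x f τ a b (h 0 ▸ ha) (h (Fin.last n) ▸ hb) := by
  obtain rfl : σ = τ := OrderHom.ext _ _ (funext h)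
  rfl

theorem eval_comp_edge {n N : ℕ} (φ : Cochain k B n) (x : Fin (N + 1) → B)
    (f : ∀ i : Fin N, x i.castSucc ⟶ x i.succ) (σ : Fin (n + 1) →o Fin (N + 1))
    (a b c : Fin (N + 1)) (ha : a ≤ σ 0) (hb : σ (Fin.last n) ≤ b) (hbc : b ≤ c) :
    φ.eval x f σ a b ha hb ≫ edge x f hbc = φ.eval x f σ a c ha (hb.trans hbc) := by
  simp [Cochain.eval, edge_comp]

theorem edge_comp_eval {n N : ℕ} (φ : Cochain k B n) (x : Fin (N + 1) → B)
    (f : ∀ i : Fin N, x i.castSucc ⟶ x i.succ) (σ : Fin (n + 1) →o Fin (N + 1))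
    (a b c : Fin (N + 1)) (ha : a ≤ σ 0) (hb : σ (Fin.last n) ≤ b) (hca : c ≤ a) :
    edge x f hca ≫ φ.eval x f σ a b ha hb = φ.eval x f σ c b (hca.trans ha) hb := by
  rw [Cochain.eval, Cochain.eval, ← Category.assoc, edge_comp]

theorem eval_eval {n m N : ℕ} (φ : Cochain k B n) (x : Fin (N + 1) → B)
    (f : ∀ i : Fin N, x i.castSucc ⟶ x i.succ) (σ : Fin (m + 1) →o Fin (N + 1))
    (τ : Fin (n + 1) →o Fin (m + 1)) (c d : Fin (m + 1)) (hc : c ≤ τ 0)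
    (hd : τ (Fin.last n) ≤ d) :
    φ.eval (fun i => x (σ i)) (fun i => edge x f (σ.monotone i.castSucc_le_succ)) τ c d hc hd =
      φ.eval x f (σ.comp τ) (σ c) (σ d) (σ.monotone hc) (σ.monotone hd) := by
  unfold Cochain.eval
  rw [edge_edge, edge_edge]
  congr 3
  funext i
  exact edge_edge x f σ _

/-- The increasing map `Fin (n + 1) → Fin (n + 2)` that misses `i`. -/
def face (n i : ℕ) : Fin (n + 1) →o Fin (n + 1 + 1) where
  toFun j := ⟨if (j : ℕ) < i then j else j + 1, by split_ifs <;> omega⟩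
  monotone' a b h := by
    rw [Fin.le_def] at h ⊢
    dsimp only
    split_ifs <;> omega

theorem face_val (n i : ℕ) (j : Fin (n + 1)) :
    (face n i j : ℕ) = j + min 1 (j + 1 - i) := by
  change (if (j : ℕ) < i then (j : ℕ) else j + 1) = _
  split_ifs <;> omega

/-- The Hochschild coboundary: `dφ` is the alternating sum of the terms `d_i φ`, `0 ≤ i ≤ n + 1`,
where, in the usual order of composition,
`(d_0 φ)(f_{n+1}, …, f_1) = φ(f_{n+1}, …, f_2) f_1`,
`(d_i φ)(f_{n+1}, …, f_1) = φ(f_{n+1}, …, f_{i+1} f_i, …, f_1)` for `1 ≤ i ≤ n`, and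
`(d_{n+1} φ)(f_{n+1}, …, f_1) = f_{n+1} φ(f_n, …, f_1)`.
All are of one form: evaluate `φ` along the vertices other than `x i`, and compose with the morphism
from `x 0` to the first of these and the one from the last of them to `x (n + 1)` (these are
identities for `1 ≤ i ≤ n`). -/
def d (n : ℕ) : Cochain k B n →ₗ[k] Cochain k B (n + 1) where
  toFun φ x := ∑ i ∈ Finset.range (n + 2), (-1 : k) ^ i •
    φ.evalMultilinear x (face n i) (Fin.zero_le _) (Fin.le_last _)
  map_add' φ ψ := by
    funext x
    ext f
    simp [Cochain.evalMultilinear, eval_add, Finset.sum_add_distrib]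
  map_smul' c φ := by
    funext x
    ext f
    simp [Cochain.evalMultilinear, eval_smul, Finset.smul_sum, smul_smul, mul_comm]

theorem d_apply {n : ℕ} (φ : Cochain k B n) (x : Fin (n + 1 + 1) → B)
    (f : ∀ i : Fin (n + 1), x i.castSucc ⟶ x i.succ) :
    d n φ x f = ∑ i ∈ Finset.range (n + 2), (-1 : k) ^ i •
      φ.eval x f (face n i) 0 (Fin.last _) (Fin.zero_le _) (Fin.le_last _) := by
  simp [d, Cochain.evalMultilinear]

theorem eval_d {n N : ℕ} (φ : Cochain k B n) (x : Fin (N + 1) → B)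
    (f : ∀ i : Fin N, x i.castSucc ⟶ x i.succ) (σ : Fin (n + 1 + 1) →o Fin (N + 1))
    (a b : Fin (N + 1)) (ha : a ≤ σ 0) (hb : σ (Fin.last _) ≤ b) :
    Cochain.eval (d n φ) x f σ a b ha hb = ∑ i ∈ Finset.range (n + 2), (-1 : k) ^ i •
      φ.eval x f (σ.comp (face n i)) a b (ha.trans (σ.monotone (Fin.zero_le _)))
        ((σ.monotone (Fin.le_last _)).trans hb) := by
  rw [Cochain.eval, d_apply, Preadditive.sum_comp, Preadditive.comp_sum]
  refine Finset.sum_congr rfl fun i _ => ?_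
  rw [eval_eval, Linear.smul_comp, Linear.comp_smul]
  congr 1
  exact (congrArg (edge x f ha ≫ ·) (eval_comp_edge φ x f (σ.comp (face n i)) _ _ _ _ _ hb)).trans
    (edge_comp_eval φ x f (σ.comp (face n i)) _ _ _ _ _ ha)

theorem d_d {n : ℕ} (φ : Cochain k B n) : d (n + 1) (d n φ) = 0 := by
  funext x
  ext f
  rw [d_apply]
  simp only [eval_d, Finset.smul_sum, smul_smul]
  let T : ℕ × ℕ → (x 0 ⟶ x (Fin.last _)) := fun p => ((-1 : k) ^ p.1 * (-1) ^ p.2) •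
      φ.eval x f ((face (n + 1) p.1).comp (face n p.2)) 0 (Fin.last _)
        (Fin.zero_le _) (Fin.le_last _)
  change ∑ i ∈ Finset.range (n + 1 + 2), ∑ j ∈ Finset.range (n + 2), T (i, j) = 0
  rw [← Finset.sum_product']
  refine Finset.sum_involution
    (fun p _ => if p.1 ≤ p.2 then (p.2 + 1, p.1) else (p.2, p.1 - 1)) ?_ ?_ ?_ ?_
  · rintro ⟨i, j⟩ hp
    dsimp only
    have key : ∀ i j : ℕ, i ≤ j → T (i, j) + T (j + 1, i) = 0 := by
      intro i j hij
      simp only [T]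
      rw [eval_congr φ x f (τ := (face (n + 1) (j + 1)).comp (face n i)) ?_, ← add_smul]
      · convert zero_smul k _
        ring
      · intro l
        apply Fin.ext
        simp only [OrderHom.comp_coe, Function.comp_apply, face_val]
        omega
    split_ifs with h
    · exact key i j h
    · obtain ⟨i, rfl⟩ : ∃ i', i = i' + 1 := ⟨i - 1, by omega⟩
      exact (add_comm _ _).trans (key j i (by omega))
  · rintro ⟨i, j⟩ hp _
    dsimp only
    split_ifs <;> simp only [ne_eq, Prod.mk.injEq] <;> omega
  · rintro ⟨i, j⟩ hp
    simp only [Finset.mem_product, Finset.mem_range] at hp ⊢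
    split_ifs <;> dsimp only <;> omega
  · rintro ⟨i, j⟩ hp
    dsimp only
    by_cases h : i ≤ j
    · rw [if_pos h, if_neg (by omega)]
      simp
    · rw [if_neg h, if_pos (by omega)]
      ext <;> dsimp only; omega

/-- The vertices `c, …, c + n` of `Fin (N + 1)`. -/
def block (n N c : ℕ) (h : c + n ≤ N) : Fin (n + 1) →o Fin (N + 1) where
  toFun i := ⟨c + i, by omega⟩
  monotone' a b hab := by
    rw [Fin.le_def] at hab ⊢
    dsimp only
    omega

theorem block_val (n N c : ℕ) (h : c + n ≤ N) (i : Fin (n + 1)) :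
    (block n N c h i : ℕ) = c + i := rfl

/-- The cup product: `(ψ ⌣ φ)(f_{n+m}, …, f_1) = ψ(f_{n+m}, …, f_{n+1}) φ(f_n, …, f_1)`, in the usual
order of composition, for `ψ` of degree `m` and `φ` of degree `n`. -/
def cup (m n : ℕ) : Cochain k B m →ₗ[k] Cochain k B n →ₗ[k] Cochain k B (m + n) :=
  LinearMap.mk₂ k
    (fun ψ φ x =>
      { toFun := fun f =>
          φ.eval x f (block n (m + n) 0 (by omega)) 0 ⟨n, by omega⟩ (Fin.zero_le _)
              (by simp [block]) ≫
            ψ.eval x f (block m (m + n) n (by omega)) ⟨n, by omega⟩ (Fin.last _)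
              (Fin.le_def.2 (Nat.le_add_right _ _)) (Fin.le_last _)
        map_update_add' := fun f j v v' => by
          rcases le_or_gt j.succ (⟨n, by omega⟩ : Fin (m + n + 1)) with h | h
          · obtain ⟨L, hL⟩ := eval_update_of_mem φ x f (block n (m + n) 0 (by omega))
              (a := 0) (b := ⟨n, by omega⟩) (Fin.zero_le _) (by simp [block]) j (Fin.zero_le _) h
            rw [hL, hL, hL, eval_update_of_not _ _ _ _ _ _ _ _ (Or.inl h),
              eval_update_of_not _ _ _ _ _ _ _ _ (Or.inl h),
              eval_update_of_not _ _ _ _ _ _ _ _ (Or.inl h), map_add, Preadditive.add_comp]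
          · have h := Fin.le_castSucc_iff.2 h
            obtain ⟨L, hL⟩ := eval_update_of_mem ψ x f (block m (m + n) n (by omega))
              (a := ⟨n, by omega⟩) (b := Fin.last _) (Fin.le_def.2 (Nat.le_add_right _ _)) (Fin.le_last _) j h
                (Fin.le_last _)
            rw [hL, hL, hL, eval_update_of_not _ _ _ _ _ _ _ _ (Or.inr h),
              eval_update_of_not _ _ _ _ _ _ _ _ (Or.inr h),
              eval_update_of_not _ _ _ _ _ _ _ _ (Or.inr h), map_add, Preadditive.comp_add]
        map_update_smul' := fun f j c v => by
          rcases le_or_gt j.succ (⟨n, by omega⟩ : Fin (m + n + 1)) with h | h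
          · obtain ⟨L, hL⟩ := eval_update_of_mem φ x f (block n (m + n) 0 (by omega))
              (a := 0) (b := ⟨n, by omega⟩) (Fin.zero_le _) (by simp [block]) j (Fin.zero_le _) h
            rw [hL, hL, eval_update_of_not _ _ _ _ _ _ _ _ (Or.inl h),
              eval_update_of_not _ _ _ _ _ _ _ _ (Or.inl h), map_smul, Linear.smul_comp]
          · have h := Fin.le_castSucc_iff.2 h
            obtain ⟨L, hL⟩ := eval_update_of_mem ψ x f (block m (m + n) n (by omega))
              (a := ⟨n, by omega⟩) (b := Fin.last _) (Fin.le_def.2 (Nat.le_add_right _ _)) (Fin.le_last _) j h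
                (Fin.le_last _)
            rw [hL, hL, eval_update_of_not _ _ _ _ _ _ _ _ (Or.inr h),
              eval_update_of_not _ _ _ _ _ _ _ _ (Or.inr h), map_smul, Linear.comp_smul] })
    (fun ψ ψ' φ => by funext x; ext f; simp [eval_add])
    (fun c ψ φ => by funext x; ext f; simp [eval_smul])
    (fun ψ φ φ' => by funext x; ext f; simp [eval_add])
    (fun c ψ φ => by funext x; ext f; simp [eval_smul])

theorem cup_apply {m n : ℕ} (ψ : Cochain k B m) (φ : Cochain k B n) (x : Fin (m + n + 1) → B)
    (f : ∀ i : Fin (m + n), x i.castSucc ⟶ x i.succ) :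
    cup m n ψ φ x f =
      φ.eval x f (block n (m + n) 0 (by omega)) 0 ⟨n, by omega⟩ (Fin.zero_le _)
          (by simp [block]) ≫
        ψ.eval x f (block m (m + n) n (by omega)) ⟨n, by omega⟩ (Fin.last _)
          (Fin.le_def.2 (Nat.le_add_right _ _)) (Fin.le_last _) :=
  rfl

/-- The unit of the cup product: the family of the identities. -/
def one : Cochain k B 0 := fun x => MultilinearMap.constOfIsEmpty k _ (𝟙 (x 0))

end Cochains

section Cohomology

variable {k : Type u} [Field k] {B : Type w} [Category.{v} B] [Preadditive B] [Linear k B]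

theorem eval_cup {m n N : ℕ} (ψ : Cochain k B m) (φ : Cochain k B n) (x : Fin (N + 1) → B)
    (f : ∀ i : Fin N, x i.castSucc ⟶ x i.succ) (σ : Fin (m + n + 1) →o Fin (N + 1))
    (a b c : Fin (N + 1)) (ha : a ≤ σ 0) (hb : σ (Fin.last _) ≤ b)
    (hc : c = σ ⟨n, by omega⟩) :
    Cochain.eval (cup m n ψ φ) x f σ a b ha hb =
      φ.eval x f (σ.comp (block n (m + n) 0 (by omega))) a c
          (ha.trans (σ.monotone (Fin.zero_le _)))
          ((σ.monotone (Fin.le_def.2 (Nat.zero_add n).le)).trans hc.ge) ≫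
        ψ.eval x f (σ.comp (block m (m + n) n (by omega))) c b
          (hc.le.trans (σ.monotone (Fin.le_def.2 le_rfl)))
          ((σ.monotone (Fin.le_last _)).trans hb) := by
  subst hc
  rw [Cochain.eval, cup_apply, eval_eval, eval_eval]
  have h1 := edge_comp_eval φ x f (σ.comp (block n (m + n) 0 (by omega))) (σ 0)
    (σ ⟨n, by omega⟩) a (σ.monotone (Fin.zero_le _))
    (σ.monotone (Fin.le_def.2 (Nat.zero_add n).le)) ha
  have h2 := eval_comp_edge ψ x f (σ.comp (block m (m + n) n (by omega))) (σ ⟨n, by omega⟩)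
    (σ (Fin.last _)) b (σ.monotone (Fin.le_def.2 le_rfl))
    (σ.monotone (Fin.le_last _)) hb
  rw [← h1, ← h2, Category.assoc, Category.assoc]

/-- The Leibniz rule, evaluated in an arbitrary sequence of morphisms. -/
theorem leibniz_eval {m n N : ℕ} (ψ : Cochain k B m) (φ : Cochain k B n) (hN : N = m + n + 1)
    (x : Fin (N + 1) → B) (f : ∀ i : Fin N, x i.castSucc ⟶ x i.succ) :
    Cochain.eval (d (m + n) (cup m n ψ φ)) x f (block (m + n + 1) N 0 (by omega)) 0 (Fin.last _)
        (Fin.zero_le _) (Fin.le_last _) =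
      Cochain.eval (d n φ) x f (block (n + 1) N 0 (by omega)) 0 ⟨n + 1, by omega⟩
          (Fin.zero_le _) (Fin.le_def.2 (by simp [block_val])) ≫
        ψ.eval x f (block m N (n + 1) (by omega)) ⟨n + 1, by omega⟩ (Fin.last _)
          (Fin.le_def.2 (by simp [block_val])) (Fin.le_last _) +
      (-1 : k) ^ n •
        (φ.eval x f (block n N 0 (by omega)) 0 ⟨n, by omega⟩
          (Fin.zero_le _) (Fin.le_def.2 (by simp [block_val])) ≫
        Cochain.eval (d m ψ) x f (block (m + 1) N n (by omega)) ⟨n, by omega⟩ (Fin.last _)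
          (Fin.le_def.2 (by simp [block_val])) (Fin.le_last _)) := by
  rw [eval_d, eval_d, eval_d]
  have hs : ∀ T : ℕ → (x 0 ⟶ x (Fin.last N)), ∑ i ∈ Finset.range (m + n + 2), T i =
      ∑ i ∈ Finset.range (n + 1), T i + ∑ i ∈ Finset.range (m + 1), T (n + 1 + i) := fun T => by
    rw [show m + n + 2 = (n + 1) + (m + 1) by omega, Finset.sum_range_add]
  rw [hs,
    Finset.sum_range_succ _ (n + 1), Finset.sum_range_succ' _ (m + 1)]
  simp only [Preadditive.add_comp, Preadditive.comp_add, Preadditive.sum_comp,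
    Preadditive.comp_sum, smul_add, Finset.smul_sum, Linear.smul_comp, Linear.comp_smul, smul_smul]
  have e1 : ∀ i ∈ Finset.range (n + 1),
      Cochain.eval (cup m n ψ φ) x f
        ((block (m + n + 1) N 0 (by omega)).comp (face (m + n) i)) 0 (Fin.last _)
        (Fin.zero_le _) (Fin.le_last _) =
      φ.eval x f ((block (n + 1) N 0 (by omega)).comp (face n i)) 0 ⟨n + 1, by omega⟩
          (Fin.zero_le _) (Fin.le_def.2 (by
            simp only [OrderHom.comp_coe, Function.comp_apply, face_val, block_val, Fin.val_last]
            omega)) ≫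
        ψ.eval x f (block m N (n + 1) (by omega)) ⟨n + 1, by omega⟩ (Fin.last _)
          (Fin.le_def.2 (by simp [block_val])) (Fin.le_last _) := by
    intro i hi
    rw [Finset.mem_range] at hi
    rw [eval_cup _ _ _ _ _ _ _ ⟨n + 1, by omega⟩ _ _ (by
      apply Fin.ext
      simp only [OrderHom.comp_coe, Function.comp_apply, face_val, block_val]
      omega)]
    congr 1
    · apply eval_congr
      intro l
      apply Fin.ext
      simp only [OrderHom.comp_coe, Function.comp_apply, face_val, block_val]
      omega
    · apply eval_congr
      intro l
      apply Fin.ext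
      simp only [OrderHom.comp_coe, Function.comp_apply, face_val, block_val]
      omega
  have e2 : ∀ i ∈ Finset.range (m + 1),
      Cochain.eval (cup m n ψ φ) x f
        ((block (m + n + 1) N 0 (by omega)).comp (face (m + n) (n + 1 + i))) 0 (Fin.last _)
        (Fin.zero_le _) (Fin.le_last _) =
      φ.eval x f (block n N 0 (by omega)) 0 ⟨n, by omega⟩
          (Fin.zero_le _) (Fin.le_def.2 (by simp [block_val])) ≫
        ψ.eval x f ((block (m + 1) N n (by omega)).comp (face m (i + 1))) ⟨n, by omega⟩
          (Fin.last _) (Fin.le_def.2 (by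
            simp only [OrderHom.comp_coe, Function.comp_apply, face_val, block_val]
            omega)) (Fin.le_last _) := by
    intro i hi
    rw [Finset.mem_range] at hi
    rw [eval_cup _ _ _ _ _ _ _ ⟨n, by omega⟩ _ _ (by
      apply Fin.ext
      simp only [OrderHom.comp_coe, Function.comp_apply, face_val, block_val]
      omega)]
    congr 1
    · apply eval_congr
      intro l
      apply Fin.ext
      simp only [OrderHom.comp_coe, Function.comp_apply, face_val, block_val]
      omega
    · apply eval_congr
      intro l
      apply Fin.ext
      simp only [OrderHom.comp_coe, Function.comp_apply, face_val, block_val]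
      omega
  rw [Finset.sum_congr rfl fun i hi => congrArg (((-1 : k) ^ i) • ·) (e1 i hi),
    Finset.sum_congr rfl fun i hi => congrArg (((-1 : k) ^ (n + 1 + i)) • ·) (e2 i hi)]
  have e3 : φ.eval x f ((block (n + 1) N 0 (by omega)).comp (face n (n + 1))) 0 ⟨n + 1, by omega⟩
        (Fin.zero_le _) (Fin.le_def.2 (by
            simp only [OrderHom.comp_coe, Function.comp_apply, face_val, block_val, Fin.val_last]
            omega)) =
      φ.eval x f (block n N 0 (by omega)) 0 ⟨n, by omega⟩
          (Fin.zero_le _) (Fin.le_def.2 (by simp [block_val])) ≫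
        edge x f (a := ⟨n, by omega⟩) (b := ⟨n + 1, by omega⟩) (Fin.le_def.2 (by simp)) := by
    rw [eval_comp_edge]
    apply eval_congr
    intro l
    apply Fin.ext
    simp only [OrderHom.comp_coe, Function.comp_apply, face_val, block_val]
    omega
  have e4 : ψ.eval x f ((block (m + 1) N n (by omega)).comp (face m 0)) ⟨n, by omega⟩ (Fin.last _)
        (Fin.le_def.2 (by
            simp only [OrderHom.comp_coe, Function.comp_apply, face_val, block_val]
            omega)) (Fin.le_last _) =
      edge x f (a := ⟨n, by omega⟩) (b := ⟨n + 1, by omega⟩) (Fin.le_def.2 (by simp)) ≫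
        ψ.eval x f (block m N (n + 1) (by omega)) ⟨n + 1, by omega⟩ (Fin.last _)
          (Fin.le_def.2 (by simp [block_val])) (Fin.le_last _) := by
    rw [edge_comp_eval]
    apply eval_congr
    intro l
    apply Fin.ext
    simp only [OrderHom.comp_coe, Function.comp_apply, face_val, block_val]
    omega
  rw [e3, e4, Category.assoc]
  have e5 : ∀ i, (-1 : k) ^ (n + 1 + i) = (-1) ^ n * (-1) ^ (i + 1) := fun i => by ring
  simp only [e5]
  rw [pow_succ (-1 : k) n]
  simp only [mul_neg, mul_one, neg_smul, pow_zero]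
  abel

theorem eval_block_self {N : ℕ} (φ : Cochain k B N) (x : Fin (N + 1) → B)
    (f : ∀ i : Fin N, x i.castSucc ⟶ x i.succ) :
    φ.eval x f (block N N 0 (by omega)) 0 (Fin.last _) (Fin.zero_le _) (Fin.le_last _) =
      φ x f := by
  rw [eval_congr φ x f (τ := OrderHom.id) (by intro i; apply Fin.ext; simp [block_val])]
  change edge x f (le_refl 0) ≫ φ x (fun i => edge x f i.castSucc_le_succ) ≫
    edge x f (le_refl (Fin.last N)) = _
  rw [edge_self, edge_self, Category.id_comp, Category.comp_id]
  exact congrArg (φ x) (funext fun i => edge_succ x f i)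

/-- Transport of cochains along an equality of degrees. -/
def castDeg {p q : ℕ} (h : p = q) (φ : Cochain k B p) : Cochain k B q := h ▸ φ

theorem castDeg_zero {p q : ℕ} (h : p = q) : castDeg h (0 : Cochain k B p) = 0 := by
  subst h
  rfl

theorem castDeg_apply {p q : ℕ} (h : p = q) (φ : Cochain k B p) (x : Fin (q + 1) → B)
    (f : ∀ i : Fin q, x i.castSucc ⟶ x i.succ) :
    castDeg h φ x f = φ.eval x f (block p q 0 (by omega)) 0 (Fin.last _) (Fin.zero_le _)
      (Fin.le_def.2 (by simp [block_val, h])) := by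
  subst h
  rw [eval_block_self]
  rfl

theorem eval_zero {n N : ℕ} (x : Fin (N + 1) → B)
    (f : ∀ i : Fin N, x i.castSucc ⟶ x i.succ) (σ : Fin (n + 1) →o Fin (N + 1))
    (a b : Fin (N + 1)) (ha : a ≤ σ 0) (hb : σ (Fin.last n) ≤ b) :
    (0 : Cochain k B n).eval x f σ a b ha hb = 0 := by
  simp [Cochain.eval]

theorem d_cup {m n : ℕ} (ψ : Cochain k B m) (φ : Cochain k B n) :
    d (m + n) (cup m n ψ φ) = cup m (n + 1) ψ (d n φ) +
      (-1 : k) ^ n • castDeg (by omega : m + 1 + n = m + n + 1) (cup (m + 1) n (d m ψ) φ) := by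
  funext x
  ext f
  have h := leibniz_eval ψ φ rfl x f
  rw [eval_block_self] at h
  refine h.trans ?_
  rw [Pi.add_apply, Pi.smul_apply, add_apply, smul_apply,
    castDeg_apply, cup_apply, eval_cup _ _ _ _ _ _ _ ⟨n, by omega⟩ _ _ (by
      apply Fin.ext; simp [block_val])]
  congr 3
  · apply eval_congr
    intro l
    apply Fin.ext
    simp [block_val]
  · apply eval_congr
    intro l
    apply Fin.ext
    simp [block_val]

variable (k B)

/-- A differential graded subalgebra of the algebra of Hochschild-Mitchell cochains of `B`. -/
structure SubDGA where
  /-- the cochains of degree `n` in the subalgebra -/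
  carrier : ∀ n, Submodule k (Cochain k B n)
  d_mem : ∀ {n} {φ : Cochain k B n}, φ ∈ carrier n → d n φ ∈ carrier (n + 1)
  cup_mem : ∀ {m n} {ψ : Cochain k B m} {φ : Cochain k B n}, ψ ∈ carrier m → φ ∈ carrier n →
    cup m n ψ φ ∈ carrier (m + n)
  one_mem : one ∈ carrier 0

/-- The algebra of all cochains. -/
def SubDGA.all : SubDGA k B where
  carrier _ := ⊤
  d_mem _ := Submodule.mem_top
  cup_mem _ _ := Submodule.mem_top
  one_mem := Submodule.mem_top

variable {k B}

namespace SubDGA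

variable (S : SubDGA k B)

/-- The cocycles of degree `n`. -/
def cocycles (n : ℕ) : Submodule k (Cochain k B n) := S.carrier n ⊓ LinearMap.ker (d n)

/-- The coboundaries of degree `n`, i.e. the image of the cochains of degree `n - 1`. -/
def coboundaries : ∀ n : ℕ, Submodule k (Cochain k B n)
  | 0 => ⊥
  | n + 1 => (S.carrier n).map (d n)

theorem coboundaries_le_cocycles : ∀ n : ℕ, S.coboundaries n ≤ S.cocycles n
  | 0 => bot_le
  | n + 1 => by
    rintro _ ⟨φ, hφ, rfl⟩
    exact ⟨S.d_mem hφ, d_d φ⟩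

/-- The cohomology in degree `n`: cocycles modulo coboundaries. -/
def Cohomology (n : ℕ) : Type (max v w) :=
  S.cocycles n ⧸ (S.coboundaries n).submoduleOf (S.cocycles n)

instance (n : ℕ) : AddCommGroup (S.Cohomology n) :=
  inferInstanceAs (AddCommGroup (S.cocycles n ⧸ (S.coboundaries n).submoduleOf (S.cocycles n)))

instance (n : ℕ) : Module k (S.Cohomology n) :=
  inferInstanceAs (Module k (S.cocycles n ⧸ (S.coboundaries n).submoduleOf (S.cocycles n)))

/-- The cohomology class of a cocycle. -/
def toClass (n : ℕ) : S.cocycles n →ₗ[k] S.Cohomology n :=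
  ((S.coboundaries n).submoduleOf (S.cocycles n)).mkQ

/-- A linear map on cocycles that vanishes on coboundaries, as a map on cohomology. -/
def Cohomology.lift {M : Type*} [AddCommGroup M] [Module k M] {n : ℕ} (F : S.cocycles n →ₗ[k] M)
    (h : ∀ φ : S.cocycles n, φ.1 ∈ S.coboundaries n → F φ = 0) : S.Cohomology n →ₗ[k] M :=
  Submodule.liftQ _ F h

theorem toClass_eq_zero {n : ℕ} (φ : S.cocycles n) (h : φ.1 ∈ S.coboundaries n) :
    S.toClass n φ = 0 :=
  (Submodule.Quotient.mk_eq_zero _).2 h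

theorem one_mem_cocycles : (one : Cochain k B 0) ∈ S.cocycles 0 := by
  refine ⟨S.one_mem, ?_⟩
  change d 0 one = 0
  funext x
  ext f
  rw [d_apply, Finset.sum_range_succ, Finset.sum_range_one]
  have h : ∀ i, Cochain.eval (one : Cochain k B 0) x f (face 0 i) 0 (Fin.last _)
      (Fin.zero_le _) (Fin.le_last _) = edge x f (Fin.zero_le _) := fun i =>
    (congrArg (edge x f (Fin.zero_le _) ≫ ·) (Category.id_comp _)).trans (edge_comp x f _ _)
  rw [h, h, pow_zero, pow_one, one_smul, neg_smul, one_smul, add_neg_cancel]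
  rfl

theorem cup_mem_cocycles {m n : ℕ} {ψ : Cochain k B m} {φ : Cochain k B n}
    (hψ : ψ ∈ S.cocycles m) (hφ : φ ∈ S.cocycles n) : cup m n ψ φ ∈ S.cocycles (m + n) := by
  refine ⟨S.cup_mem hψ.1 hφ.1, ?_⟩
  have h1 : d m ψ = 0 := hψ.2
  have h2 : d n φ = 0 := hφ.2
  change d (m + n) (cup m n ψ φ) = 0
  rw [d_cup, h1, h2]
  simp only [map_zero, LinearMap.zero_apply, zero_add]
  rw [castDeg_zero, smul_zero]

theorem cup_mem_coboundaries_right {m n : ℕ} {ψ : Cochain k B m} {φ : Cochain k B n}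
    (hψ : ψ ∈ S.cocycles m) (hφ : φ ∈ S.coboundaries n) :
    cup m n ψ φ ∈ S.coboundaries (m + n) := by
  cases n with
  | zero =>
    obtain rfl : φ = 0 := hφ
    rw [map_zero]
    exact zero_mem _
  | succ n =>
    obtain ⟨χ, hχ, rfl⟩ := hφ
    have h1 : d m ψ = 0 := hψ.2
    refine ⟨cup m n ψ χ, S.cup_mem hψ.1 hχ, ?_⟩
    change d (m + n) (cup m n ψ χ) = cup m (n + 1) ψ (d n χ)
    rw [d_cup, h1]
    rw [map_zero, LinearMap.zero_apply, castDeg_zero, smul_zero, add_zero]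

theorem castDeg_mem_coboundaries {p q : ℕ} (h : p = q) {φ : Cochain k B p} :
    castDeg h φ ∈ S.coboundaries q ↔ φ ∈ S.coboundaries p := by
  subst h
  rfl

theorem cup_mem_coboundaries_left {m n : ℕ} {ψ : Cochain k B m} {φ : Cochain k B n}
    (hψ : ψ ∈ S.coboundaries m) (hφ : φ ∈ S.cocycles n) :
    cup m n ψ φ ∈ S.coboundaries (m + n) := by
  cases m with
  | zero =>
    obtain rfl : ψ = 0 := hψ
    rw [map_zero, LinearMap.zero_apply]
    exact zero_mem _
  | succ m =>
    obtain ⟨χ, hχ, rfl⟩ := hψ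
    have h1 : d n φ = 0 := hφ.2
    have h2 := d_cup χ φ
    rw [h1, map_zero, zero_add] at h2
    have h3 : d (m + n) (cup m n χ φ) ∈ S.coboundaries (m + n + 1) :=
      ⟨cup m n χ φ, S.cup_mem hχ hφ.1, rfl⟩
    rw [h2] at h3
    have h4 := Submodule.smul_mem _ ((-1 : k) ^ n) h3
    rw [smul_smul, ← mul_pow] at h4
    simp only [mul_neg, mul_one, neg_neg, one_pow, one_smul] at h4
    exact (S.castDeg_mem_coboundaries _).1 h4

/-- The cup product of cocycles. -/
def cupCocycles (m n : ℕ) : S.cocycles m →ₗ[k] S.cocycles n →ₗ[k] S.cocycles (m + n) :=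
  LinearMap.mk₂ k (fun ψ φ => ⟨cup m n ψ.1 φ.1, S.cup_mem_cocycles ψ.2 φ.2⟩)
    (fun ψ ψ' φ => Subtype.ext (LinearMap.map_add₂ (cup m n) ψ.1 ψ'.1 φ.1))
    (fun c ψ φ => Subtype.ext (LinearMap.map_smul₂ (cup m n) c ψ.1 φ.1))
    (fun ψ φ φ' => Subtype.ext (map_add (cup m n ψ.1) φ.1 φ'.1))
    (fun c ψ φ => Subtype.ext (map_smul (cup m n ψ.1) c φ.1))

/-- The product of the cohomology algebra, induced by the cup product of cocycles. -/
def hcup (m n : ℕ) : S.Cohomology m →ₗ[k] S.Cohomology n →ₗ[k] S.Cohomology (m + n) :=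
  Cohomology.lift S
    (LinearMap.flip (Cohomology.lift S ((S.cupCocycles m n).compr₂ (S.toClass (m + n))).flip
      fun φ hφ => LinearMap.ext fun ψ =>
        S.toClass_eq_zero _ (S.cup_mem_coboundaries_right ψ.2 hφ)))
    fun ψ hψ => LinearMap.ext fun c => by
      obtain ⟨φ, rfl⟩ := Submodule.mkQ_surjective _ c
      exact S.toClass_eq_zero _ (S.cup_mem_coboundaries_left hψ φ.2)

theorem hcup_toClass {m n : ℕ} (ψ : S.cocycles m) (φ : S.cocycles n) :
    S.hcup m n (S.toClass m ψ) (S.toClass n φ) =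
      S.toClass (m + n) (S.cupCocycles m n ψ φ) := rfl

/-- The unit of the cohomology algebra. -/
def hone : S.Cohomology 0 := S.toClass 0 ⟨one, S.one_mem_cocycles⟩

end SubDGA

end Cohomology

section Action

/-- An action of the group `G` on the `k`-category `C` by `k`-linear automorphisms of `C` that
extends the given action on the set of objects. The equalities `1 f = f` and `(s t) f = s (t f)`
are between morphisms whose sources and targets are equal by the laws of the action on objects. -/
class KAction (k : Type u) [Field k] (G : Type u₁) [Group G] (C : Type w) [Category.{v} C]
    [Preadditive C] [Linear k C] [MulAction G C] where
  /-- the action on morphisms -/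
  act : ∀ (s : G) {x y : C}, (x ⟶ y) →ₗ[k] (s • x ⟶ s • y)
  act_id : ∀ (s : G) (x : C), act s (𝟙 x) = 𝟙 (s • x)
  act_comp : ∀ (s : G) {x y z : C} (f : x ⟶ y) (g : y ⟶ z), act s (f ≫ g) = act s f ≫ act s g
  one_act : ∀ {x y : C} (f : x ⟶ y), HEq (act 1 f) f
  mul_act : ∀ (s t : G) {x y : C} (f : x ⟶ y), HEq (act (s * t) f) (act s (act t f))

/-- The action on objects is free. -/
class FreeOnObjects (G : Type u₁) [Group G] (C : Type w) [MulAction G C] : Prop where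
  eq_one_of_smul_eq : ∀ (s : G) (x : C), s • x = x → s = 1

variable (k : Type u) [Field k] {G : Type u₁} [Group G] {C : Type w} [Category.{v} C]
  [Preadditive C] [Linear k C] [MulAction G C] [KAction k G C]

/-- The image `s f` of the morphism `f` under `s`. -/
abbrev act (s : G) {x y : C} : (x ⟶ y) →ₗ[k] (s • x ⟶ s • y) := KAction.act s

theorem act_heq_self (t : G) (ht : t = 1) {x y : C} (f : x ⟶ y) : HEq (act k t f) f := by
  subst ht
  exact KAction.one_act f

theorem act_act_heq (s t r : G) (h : s * t = r) {x y : C} (f : x ⟶ y) :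
    HEq (act k s (act k t f)) (act k r f) := by
  subst h
  exact (KAction.mul_act s t f).symm

theorem act_act_heq_self (s t : G) (h : s * t = 1) {x y : C} (f : x ⟶ y) :
    HEq (act k s (act k t f)) f :=
  (act_act_heq k s t 1 h f).trans (act_heq_self k 1 rfl f)

theorem act_heq (s : G) {x y x' y' : C} (hx : x = x') (hy : y = y') {f : x ⟶ y} {f' : x' ⟶ y'}
    (h : HEq f f') : HEq (act k s f) (act k s f') := by
  subst hx hy
  rw [eq_of_heq h]

variable {k}

theorem cochain_heq {n : ℕ} (φ : Cochain k C n) {x x' : Fin (n + 1) → C} (hx : x = x')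
    {f : ∀ i : Fin n, x i.castSucc ⟶ x i.succ} {f' : ∀ i : Fin n, x' i.castSucc ⟶ x' i.succ}
    (h : ∀ i, HEq (f i) (f' i)) : HEq (φ x f) (φ x' f') := by
  subst hx
  rw [show f = f' from funext fun i => eq_of_heq (h i)]

theorem eqToHom_conj_heq {C : Type w} [Category.{v} C] {x y x' y' : C} (hx : x' = x) (hy : y = y') (f : x ⟶ y) :
    HEq (eqToHom hx ≫ f ≫ eqToHom hy) f := by
  subst hx hy
  simp

variable (k) in
/-- Two cochains that agree on all sequences of the form `s f` are equal. -/
theorem cochain_ext (s : G) {n : ℕ} {φ ψ : Cochain k C n}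
    (h : ∀ (x : Fin (n + 1) → C) (f : ∀ i : Fin n, x i.castSucc ⟶ x i.succ),
      φ (fun i => s • x i) (fun i => act k s (f i)) =
        ψ (fun i => s • x i) (fun i => act k s (f i))) : φ = ψ := by
  funext x
  ext f
  have hx : (fun i => s • s⁻¹ • x i) = x := funext fun i => smul_inv_smul s (x i)
  have hf : ∀ i, HEq (act k s (act k s⁻¹ (f i))) (f i) :=
    fun i => act_act_heq_self k s s⁻¹ (mul_inv_cancel s) (f i)
  exact eq_of_heq ((cochain_heq φ hx hf).symm.trans ((heq_of_eq
    (h (fun i => s⁻¹ • x i) fun i => act k s⁻¹ (f i))).trans (cochain_heq ψ hx hf)))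

/-- The action of `s` on cochains: `(s φ)(f_n, …, f_1) = s (φ(s⁻¹ f_n, …, s⁻¹ f_1))`, where the
equality `s (s⁻¹ x) = x` of objects is used to obtain a morphism from `x 0` to `x n`. -/
def actCochain (s : G) (n : ℕ) : Cochain k C n →ₗ[k] Cochain k C n where
  toFun φ x := (Linear.leftComp k _ (eqToHom (smul_inv_smul s (x 0)).symm) ∘ₗ
      Linear.rightComp k _ (eqToHom (smul_inv_smul s (x (Fin.last n)))) ∘ₗ
      act k s).compMultilinearMap
    ((φ fun i => s⁻¹ • x i).compLinearMap fun _ => act k s⁻¹)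
  map_add' φ ψ := by
    funext x
    ext f
    simp
  map_smul' c φ := by
    funext x
    ext f
    simp

theorem actCochain_apply (s : G) {n : ℕ} (φ : Cochain k C n) (x : Fin (n + 1) → C)
    (f : ∀ i : Fin n, x i.castSucc ⟶ x i.succ) :
    actCochain s n φ x f = eqToHom (smul_inv_smul s (x 0)).symm ≫
      act k s (φ (fun i => s⁻¹ • x i) (fun i => act k s⁻¹ (f i))) ≫
        eqToHom (smul_inv_smul s (x (Fin.last n))) := by
  simp [actCochain]

theorem actCochain_act (s : G) {n : ℕ} (φ : Cochain k C n) (x : Fin (n + 1) → C)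
    (f : ∀ i : Fin n, x i.castSucc ⟶ x i.succ) :
    actCochain s n φ (fun i => s • x i) (fun i => act k s (f i)) = act k s (φ x f) := by
  rw [actCochain_apply]
  refine eq_of_heq ((eqToHom_conj_heq _ _ _).trans ?_)
  refine act_heq k s (inv_smul_smul _ _) (inv_smul_smul _ _) ?_
  exact cochain_heq φ (funext fun i => inv_smul_smul s (x i))
    fun i => act_act_heq_self k s⁻¹ s (inv_mul_cancel s) (f i)

variable (k C) in
/-- The representation of `G` on the cochains of degree `n`. -/
def cochainRep (n : ℕ) : Representation k G (Cochain k C n) where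
  toFun s := actCochain s n
  map_one' := by
    refine LinearMap.ext fun φ => cochain_ext k (1 : G) fun x f => ?_
    rw [actCochain_act]
    refine eq_of_heq ((act_heq_self k 1 rfl _).trans ?_)
    exact (cochain_heq φ (funext fun i => one_smul G (x i))
      fun i => act_heq_self k 1 rfl (f i)).symm
  map_mul' s t := by
    refine LinearMap.ext fun φ => cochain_ext k (s * t) fun x f => ?_
    rw [actCochain_act]
    refine eq_of_heq ((act_act_heq k s t _ rfl _).symm.trans ?_)
    refine (heq_of_eq ((congrArg (act k s) (actCochain_act t φ x f).symm).trans
      (actCochain_act s (actCochain t n φ) (fun i => t • x i) fun i => act k t (f i)).symm)).trans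
      ?_
    exact cochain_heq _ (funext fun i => (mul_smul s t (x i)).symm)
      fun i => act_act_heq k s t _ rfl _

theorem edge_act (s : G) {n : ℕ} (x : Fin (n + 1) → C)
    (f : ∀ i : Fin n, x i.castSucc ⟶ x i.succ) {a b : Fin (n + 1)} (hab : a ≤ b) :
    edge (fun i => s • x i) (fun i => act k s (f i)) hab = act k s (edge x f hab) := by
  refine edge_unique (fun i => s • x i) _ (fun _ _ h => act k s (edge x f h)) (fun a => ?_)
    (fun a j h => ?_) hab (fun i _ _ => ?_)
  · rw [edge_self]
    exact KAction.act_id s (x a)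
  · rw [← edge_comp x f h j.castSucc_le_succ]
    exact KAction.act_comp s _ _
  · rw [edge_succ]

theorem eval_actCochain (s : G) {n N : ℕ} (φ : Cochain k C n) (x : Fin (N + 1) → C)
    (f : ∀ i : Fin N, x i.castSucc ⟶ x i.succ) (σ : Fin (n + 1) →o Fin (N + 1))
    (a b : Fin (N + 1)) (ha : a ≤ σ 0) (hb : σ (Fin.last n) ≤ b) :
    Cochain.eval (actCochain s n φ) (fun i => s • x i) (fun i => act k s (f i)) σ a b ha hb =
      act k s (φ.eval x f σ a b ha hb) := by
  unfold Cochain.eval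
  rw [edge_act, edge_act, KAction.act_comp, KAction.act_comp]
  have h : actCochain s n φ (fun i => s • x (σ i)) (fun i => edge (fun i => s • x i)
      (fun i => act k s (f i)) (σ.monotone i.castSucc_le_succ)) =
      act k s (φ (fun i => x (σ i)) fun i => edge x f (σ.monotone i.castSucc_le_succ)) :=
    (congrArg (actCochain s n φ fun i => s • x (σ i)) (funext fun i => edge_act s x f _)).trans
      (actCochain_act s φ _ _)
  exact congrArg (fun t => act k s (edge x f ha) ≫ t ≫ act k s (edge x f hb)) h

theorem d_actCochain (s : G) {n : ℕ} (φ : Cochain k C n) :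
    d n (actCochain s n φ) = actCochain s (n + 1) (d n φ) := by
  refine cochain_ext k s fun x f => ?_
  rw [actCochain_act, d_apply, d_apply, map_sum]
  refine Finset.sum_congr rfl fun i _ => ?_
  rw [eval_actCochain, map_smul]

theorem cup_actCochain (s : G) {m n : ℕ} (ψ : Cochain k C m) (φ : Cochain k C n) :
    cup m n (actCochain s m ψ) (actCochain s n φ) = actCochain s (m + n) (cup m n ψ φ) := by
  refine cochain_ext k s fun x f => ?_
  rw [actCochain_act, cup_apply, cup_apply, eval_actCochain, eval_actCochain, KAction.act_comp]

theorem actCochain_one (s : G) : actCochain s 0 (one : Cochain k C 0) = one := by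
  refine cochain_ext k s fun x f => ?_
  rw [actCochain_act]
  exact KAction.act_id s (x 0)

variable (k G C)

/-- The differential graded algebra of the invariant cochains. -/
def invariantCochains : SubDGA k C where
  carrier n := (cochainRep k (G := G) C n).invariants
  d_mem {n φ} h s := (d_actCochain s φ).symm.trans (congrArg (d n) (h s))
  cup_mem {m n ψ φ} hψ hφ s :=
    (cup_actCochain s ψ φ).symm.trans (congrArg₂ (fun a b => cup m n a b) (hψ s) (hφ s))
  one_mem s := actCochain_one s

/-- The Hochschild-Mitchell cohomology of `C` in degree `n`. -/
abbrev HH (n : ℕ) : Type (max v w) := (SubDGA.all k C).Cohomology n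

variable {G C}

/-- The action of `s` on the cocycles of `C`. -/
def actCocycles (s : G) (n : ℕ) :
    (SubDGA.all k C).cocycles n →ₗ[k] (SubDGA.all k C).cocycles n :=
  (actCochain s n).restrict fun φ hφ => ⟨Submodule.mem_top, by
    have h : d n φ = 0 := hφ.2
    change d n (actCochain s n φ) = 0
    rw [d_actCochain, h, map_zero]⟩

theorem actCochain_mem_coboundaries (s : G) :
    ∀ (n : ℕ) {φ : Cochain k C n}, φ ∈ (SubDGA.all k C).coboundaries n →
      actCochain s n φ ∈ (SubDGA.all k C).coboundaries n
  | 0, φ, h => by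
    obtain rfl : φ = 0 := h
    rw [map_zero]
    exact zero_mem _
  | n + 1, _, ⟨χ, _, rfl⟩ => ⟨actCochain s n χ, Submodule.mem_top, d_actCochain s χ⟩

variable (G C)

/-- The representation of `G` on the Hochschild-Mitchell cohomology of `C`, induced by the
action on cochains. -/
def cohomologyRep (n : ℕ) : Representation k G (HH k C n) where
  toFun s := SubDGA.Cohomology.lift _ ((SubDGA.all k C).toClass n ∘ₗ actCocycles k s n)
    fun _ hφ => SubDGA.toClass_eq_zero _ _ (actCochain_mem_coboundaries k s n hφ)
  map_one' := by
    refine LinearMap.ext fun c => ?_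
    obtain ⟨φ, rfl⟩ := Submodule.mkQ_surjective _ c
    exact congrArg ((SubDGA.all k C).toClass n)
      (Subtype.ext (LinearMap.congr_fun (map_one (cochainRep k (G := G) C n)) φ.1))
  map_mul' s t := by
    refine LinearMap.ext fun c => ?_
    obtain ⟨φ, rfl⟩ := Submodule.mkQ_surjective _ c
    exact congrArg ((SubDGA.all k C).toClass n)
      (Subtype.ext (LinearMap.congr_fun (map_mul (cochainRep k (G := G) C n) s t) φ.1))

/-- The invariants functor, from the representations of `G` over `k` to the `k`-vector spaces, is
exact. -/
def InvariantsExact (k : Type u) [Field k] (G : Type u₁) [Group G] : Prop :=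
  ∀ S : ShortComplex (Rep.{max u u₁} k G), S.ShortExact →
    (S.map (Rep.invariantsFunctor k G)).ShortExact

end Action

section Quotient

/-- The set of objects of the quotient category: the orbits of the action on objects. -/
def QuotCat (_k : Type u) (G : Type u₁) [Group G] (C : Type w) [MulAction G C] : Type w :=
  MulAction.orbitRel.Quotient G C

variable (k : Type u) [Field k] (G : Type u₁) [Group G] {C : Type w} [Category.{v} C]
  [Preadditive C] [Linear k C] [MulAction G C] [KAction k G C]

/-- The orbit of an object. -/
def orb {C : Type w} [MulAction G C] (x : C) : QuotCat k G C := Quotient.mk _ x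

variable {k G}

theorem orb_smul {C : Type w} [MulAction G C] (s : G) (x : C) :
    orb k G (s • x) = orb k G x :=
  Quotient.sound ⟨s, rfl⟩

theorem exists_smul_of_orb {C : Type w} [MulAction G C] {x y : C} (h : orb k G x = orb k G y) :
    ∃ s : G, s • x = y :=
  Quotient.exact h.symm

theorem exists_orb {C : Type w} [MulAction G C] (α : QuotCat k G C) : ∃ x, orb k G x = α :=
  Quotient.exists_rep α

/-- The pairs of an object in the orbit `α` and an object in the orbit `β`. -/
abbrev Pairs (α β : QuotCat k G C) : Type w :=
  {p : C × C // orb k G p.1 = α ∧ orb k G p.2 = β}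

instance (α β : QuotCat k G C) : DecidableEq (Pairs α β) := Classical.decEq _

/-- The direct sum of the spaces of morphisms `x ⟶ y` over `x` in `α` and `y` in `β`. -/
abbrev PreHom (α β : QuotCat k G C) : Type (max v w) :=
  DirectSum (Pairs α β) fun p => (p.1.1 ⟶ p.1.2)

/-- The inclusion of a summand. -/
def incl {α β : QuotCat k G C} {x y : C} (hx : orb k G x = α) (hy : orb k G y = β) :
    (x ⟶ y) →ₗ[k] PreHom α β :=
  DirectSum.lof k (Pairs α β) (fun p => (p.1.1 ⟶ p.1.2)) ⟨(x, y), hx, hy⟩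

theorem incl_heq {α β : QuotCat k G C} {x y x' y' : C} (hx : orb k G x = α) (hy : orb k G y = β)
    (ex : x = x') (ey : y = y') {f : x ⟶ y} {f' : x' ⟶ y'} (hf : HEq f f') :
    incl hx hy f = incl (ex ▸ hx) (ey ▸ hy) f' := by
  subst ex ey
  rw [eq_of_heq hf]

theorem preHom_ext {α β : QuotCat k G C} {M : Type*} [AddCommGroup M] [Module k M]
    {F F' : PreHom α β →ₗ[k] M}
    (h : ∀ {x y : C} (hx : orb k G x = α) (hy : orb k G y = β) (f : x ⟶ y),
      F (incl hx hy f) = F' (incl hx hy f)) : F = F' := by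
  refine DirectSum.linearMap_ext _ ?_
  rintro ⟨⟨x, y⟩, hx, hy⟩
  ext f
  exact h hx hy f

/-- The map from the direct sum determined by maps on the summands. -/
def preLift {α β : QuotCat k G C} {M : Type*} [AddCommGroup M] [Module k M]
    (F : ∀ {x y : C}, orb k G x = α → orb k G y = β → ((x ⟶ y) →ₗ[k] M)) : PreHom α β →ₗ[k] M :=
  DirectSum.toModule k _ M fun p => F p.2.1 p.2.2

theorem preLift_incl {α β : QuotCat k G C} {M : Type*} [AddCommGroup M] [Module k M]
    (F : ∀ {x y : C}, orb k G x = α → orb k G y = β → ((x ⟶ y) →ₗ[k] M))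
    {x y : C} (hx : orb k G x = α) (hy : orb k G y = β) (f : x ⟶ y) :
    preLift F (incl hx hy f) = F hx hy f :=
  DirectSum.toModule_lof (φ := fun p : Pairs α β => F p.2.1 p.2.2) k ⟨(x, y), hx, hy⟩ f

/-- The action of `G` on the direct sum of the morphism spaces from `α` to `β`. -/
def preHomRep (α β : QuotCat k G C) : Representation k G (PreHom α β) where
  toFun s := preLift fun {x y} hx hy =>
    incl ((orb_smul s x).trans hx) ((orb_smul s y).trans hy) ∘ₗ act k s
  map_one' := by
    refine preHom_ext fun hx hy f => ?_
    rw [preLift_incl]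
    exact incl_heq ((orb_smul 1 _).trans hx) ((orb_smul 1 _).trans hy) (one_smul G _) (one_smul G _) (act_heq_self k 1 rfl f)
  map_mul' s t := by
    refine preHom_ext fun hx hy f => ?_
    rw [preLift_incl, Module.End.mul_apply, preLift_incl, LinearMap.comp_apply,
      LinearMap.comp_apply, preLift_incl]
    exact incl_heq ((orb_smul (s * t) _).trans hx) ((orb_smul (s * t) _).trans hy) (mul_smul s t _) (mul_smul s t _) (act_act_heq k s t _ rfl f).symm

theorem preHomRep_incl {α β : QuotCat k G C} (s : G) {x y : C} (hx : orb k G x = α)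
    (hy : orb k G y = β) (f : x ⟶ y) :
    preHomRep α β s (incl hx hy f) =
      incl ((orb_smul s x).trans hx) ((orb_smul s y).trans hy) (act k s f) :=
  preLift_incl _ hx hy f

/-- The morphisms from `α` to `β` in the quotient category: the coinvariants of the direct sum of
the spaces of morphisms from the objects of `α` to the objects of `β`. -/
abbrev QuotHom (α β : QuotCat k G C) : Type (max v w) :=
  Representation.Coinvariants (preHomRep α β)

/-- The class in the quotient category of a morphism of `C`. -/
def cl {α β : QuotCat k G C} {x y : C} (hx : orb k G x = α) (hy : orb k G y = β) :
    (x ⟶ y) →ₗ[k] QuotHom α β :=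
  Representation.Coinvariants.mk _ ∘ₗ incl hx hy

theorem cl_heq {α β : QuotCat k G C} {x y x' y' : C} (hx : orb k G x = α) (hy : orb k G y = β)
    (hx' : orb k G x' = α) (hy' : orb k G y' = β) (ex : x = x') (ey : y = y') {f : x ⟶ y}
    {f' : x' ⟶ y'} (hf : HEq f f') : cl hx hy f = cl hx' hy' f' := by
  subst ex ey
  rw [eq_of_heq hf]

theorem cl_act {α β : QuotCat k G C} (s : G) {x y : C} (hx : orb k G x = α) (hy : orb k G y = β)
    (hx' : orb k G (s • x) = α) (hy' : orb k G (s • y) = β) (f : x ⟶ y) :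
    cl hx' hy' (act k s f) = cl hx hy f := by
  have h := Representation.Coinvariants.mk_self_apply (preHomRep α β) s (incl hx hy f)
  rw [preHomRep_incl] at h
  exact h

theorem quotHom_ext {α β : QuotCat k G C} {M : Type*} [AddCommGroup M] [Module k M]
    {F F' : QuotHom α β →ₗ[k] M}
    (h : ∀ {x y : C} (hx : orb k G x = α) (hy : orb k G y = β) (f : x ⟶ y),
      F (cl hx hy f) = F' (cl hx hy f)) : F = F' :=
  Representation.Coinvariants.hom_ext (preHom_ext h)

/-- A map from the coinvariants determined by compatible maps on the summands. -/
def quotLift {α β : QuotCat k G C} {M : Type*} [AddCommGroup M] [Module k M]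
    (F : ∀ {x y : C}, orb k G x = α → orb k G y = β → ((x ⟶ y) →ₗ[k] M))
    (hF : ∀ (s : G) {x y : C} (hx : orb k G x = α) (hy : orb k G y = β) (f : x ⟶ y),
      F ((orb_smul s x).trans hx) ((orb_smul s y).trans hy) (act k s f) = F hx hy f) :
    QuotHom α β →ₗ[k] M :=
  Representation.Coinvariants.lift _ (preLift F) fun s => preHom_ext fun hx hy f => by
    rw [LinearMap.comp_apply, preHomRep_incl, preLift_incl, preLift_incl, hF]

theorem quotLift_cl {α β : QuotCat k G C} {M : Type*} [AddCommGroup M] [Module k M]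
    (F : ∀ {x y : C}, orb k G x = α → orb k G y = β → ((x ⟶ y) →ₗ[k] M))
    (hF : ∀ (s : G) {x y : C} (hx : orb k G x = α) (hy : orb k G y = β) (f : x ⟶ y),
      F ((orb_smul s x).trans hx) ((orb_smul s y).trans hy) (act k s f) = F hx hy f)
    {x y : C} (hx : orb k G x = α) (hy : orb k G y = β) (f : x ⟶ y) :
    quotLift F hF (cl hx hy f) = F hx hy f :=
  preLift_incl F hx hy f

theorem act_comp_eqToHom_heq (t s : G) {x y y' z : C} (h : s • y = y') (h' : (t * s) • y = t • y')
    (f : x ⟶ y) (g : y' ⟶ z) :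
    HEq (act k t (act k s f ≫ eqToHom h ≫ g)) (act k (t * s) f ≫ eqToHom h' ≫ act k t g) := by
  subst h
  rw [eqToHom_refl, Category.id_comp, KAction.act_comp]
  have key : ∀ {a b a' b' c : C} (ea : a = a') (eb : b = b') (eb' : b' = b) (p : a ⟶ b)
      (p' : a' ⟶ b') (q : b ⟶ c), HEq p p' → HEq (p ≫ q) (p' ≫ eqToHom eb' ≫ q) := by
    rintro a b _ _ c rfl rfl _ p p' q hp
    rw [eq_of_heq hp]
    simp
  exact key (mul_smul t s x).symm (mul_smul t s y).symm _ _ _ _ (act_act_heq k t s _ rfl f)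

theorem smul_unique [FreeOnObjects G C] {s t : G} {y y' : C} (hs : s • y = y')
    (ht : t • y = y') : s = t := by
  have : (t⁻¹ * s) • y = y := by rw [mul_smul, hs, ← ht, inv_smul_smul]
  have := FreeOnObjects.eq_one_of_smul_eq _ _ this
  rw [inv_mul_eq_one] at this
  exact this.symm

/-- For `f : x ⟶ y` and `g : y' ⟶ z` with `y` and `y'` in one orbit, the class of `g ∘ s f`, where
`s y = y'`. -/
def compAux {α β γ : QuotCat k G C} {x y y' z : C} (hx : orb k G x = α) (hy : orb k G y = β)
    (hy' : orb k G y' = β) (hz : orb k G z = γ) : (x ⟶ y) →ₗ[k] (y' ⟶ z) →ₗ[k] QuotHom α γ :=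
  have h := exists_smul_of_orb (hy.trans hy'.symm)
  LinearMap.mk₂ k
    (fun f g => cl ((orb_smul h.choose x).trans hx) hz
      (act k h.choose f ≫ eqToHom h.choose_spec ≫ g))
    (by intros; simp) (by intros; simp) (by intros; simp) (by intros; simp)

theorem compAux_eq [FreeOnObjects G C] {α β γ : QuotCat k G C} {x y y' z : C}
    (hx : orb k G x = α) (hy : orb k G y = β) (hy' : orb k G y' = β) (hz : orb k G z = γ)
    (f : x ⟶ y) (g : y' ⟶ z) (s : G) (hs : s • y = y') :
    compAux hx hy hy' hz f g =
      cl ((orb_smul s x).trans hx) hz (act k s f ≫ eqToHom hs ≫ g) := by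
  have h := exists_smul_of_orb (hy.trans hy'.symm)
  obtain rfl : s = h.choose := smul_unique hs h.choose_spec
  rfl

/-- Every morphism from `α` to `β` is a sum of classes of morphisms with a given source. -/
theorem quotHom_ext_source {α β : QuotCat k G C} {M : Type*} [AddCommGroup M] [Module k M]
    {F F' : QuotHom α β →ₗ[k] M} {x : C} (hx : orb k G x = α)
    (h : ∀ {y : C} (hy : orb k G y = β) (f : x ⟶ y), F (cl hx hy f) = F' (cl hx hy f)) :
    F = F' := by
  refine quotHom_ext fun {x' y} hx' hy f => ?_
  obtain ⟨s, rfl⟩ := exists_smul_of_orb (hx'.trans hx.symm)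
  have e := cl_act s hx' hy hx ((orb_smul s y).trans hy) f
  rw [← e]
  exact h _ _

variable [FreeOnObjects G C]

theorem compAux_act_right {α β γ : QuotCat k G C} {x y y' z : C}
    (hx : orb k G x = α) (hy : orb k G y = β) (hy' : orb k G y' = β) (hz : orb k G z = γ)
    (f : x ⟶ y) (g : y' ⟶ z) (t : G) :
    compAux hx hy ((orb_smul t y').trans hy') ((orb_smul t z).trans hz) f (act k t g) =
      compAux hx hy hy' hz f g := by
  obtain ⟨s, hs⟩ := exists_smul_of_orb (hy.trans hy'.symm)
  have hs' : (t * s) • y = t • y' := by rw [mul_smul, hs]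
  rw [compAux_eq hx hy hy' hz f g s hs, compAux_eq _ _ _ _ _ _ (t * s) hs',
    ← cl_act t ((orb_smul s x).trans hx) hz
      ((orb_smul t _).trans ((orb_smul s x).trans hx)) ((orb_smul t z).trans hz)]
  exact cl_heq _ _ _ _ (mul_smul t s x) rfl (act_comp_eqToHom_heq t s hs hs' f g).symm

theorem compAux_act_left {α β γ : QuotCat k G C} {x y y' z : C}
    (hx : orb k G x = α) (hy : orb k G y = β) (hy' : orb k G y' = β) (hz : orb k G z = γ)
    (f : x ⟶ y) (g : y' ⟶ z) (t : G) :
    compAux ((orb_smul t x).trans hx) ((orb_smul t y).trans hy) hy' hz (act k t f) g =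
      compAux hx hy hy' hz f g := by
  obtain ⟨s, hs⟩ := exists_smul_of_orb (hy.trans hy'.symm)
  have hs' : (s * t⁻¹) • t • y = y' := by rw [mul_smul, inv_smul_smul, hs]
  rw [compAux_eq hx hy hy' hz f g s hs, compAux_eq _ _ _ _ _ _ (s * t⁻¹) hs']
  have key : ∀ {a b a' b' c d : C} (ea : a = a') (eb : b = b') (e : b = c) (e' : b' = c)
      (p : a ⟶ b) (p' : a' ⟶ b') (q : c ⟶ d), HEq p p' →
      HEq (p ≫ eqToHom e ≫ q) (p' ≫ eqToHom e' ≫ q) := by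
    rintro a b _ _ c d rfl rfl rfl _ p p' q hp
    rw [eq_of_heq hp]
  have e1 : ∀ c : C, (s * t⁻¹) • t • c = s • c := fun c => by rw [mul_smul, inv_smul_smul]
  exact cl_heq _ _ _ _ (e1 x) rfl (key (e1 x) (e1 y) _ _ _ _ _
    (act_act_heq k (s * t⁻¹) t s (by group) f))

/-- The composition of the quotient category. -/
def quotComp (α β γ : QuotCat k G C) : QuotHom α β →ₗ[k] QuotHom β γ →ₗ[k] QuotHom α γ :=
  quotLift
    (fun hx hy => LinearMap.flip (quotLift (fun hy' hz => (compAux hx hy hy' hz).flip)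
      fun t _ _ hy' hz g => LinearMap.ext fun f => compAux_act_right hx hy hy' hz f g t))
    fun t _ _ hx hy f => quotHom_ext fun hy' hz g => by
      rw [LinearMap.flip_apply, LinearMap.flip_apply, quotLift_cl, quotLift_cl]
      exact compAux_act_left hx hy hy' hz f g t

/-- The composition is the one of the definition: the composite of the classes of `f : x ⟶ y` and
of `g : y' ⟶ z` is the class of `g ∘ s f`, where `s y = y'`. -/
theorem quotComp_cl {α β γ : QuotCat k G C} {x y y' z : C}
    (hx : orb k G x = α) (hy : orb k G y = β) (hy' : orb k G y' = β) (hz : orb k G z = γ)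
    (f : x ⟶ y) (g : y' ⟶ z) (s : G) (hs : s • y = y') :
    quotComp α β γ (cl hx hy f) (cl hy' hz g) =
      cl ((orb_smul s x).trans hx) hz (act k s f ≫ eqToHom hs ≫ g) := by
  rw [quotComp, quotLift_cl, LinearMap.flip_apply, quotLift_cl, LinearMap.flip_apply,
    compAux_eq _ _ _ _ _ _ s hs]

theorem quotComp_cl_self {α β γ : QuotCat k G C} {x y z : C}
    (hx : orb k G x = α) (hy : orb k G y = β) (hz : orb k G z = γ) (f : x ⟶ y) (g : y ⟶ z) :
    quotComp α β γ (cl hx hy f) (cl hy hz g) = cl hx hz (f ≫ g) := by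
  rw [quotComp_cl hx hy hy hz f g 1 (one_smul G y)]
  refine cl_heq _ _ _ _ (one_smul G x) rfl ?_
  have key : ∀ {a b a' b' c : C} (ea : a = a') (eb : b = b') (e : b = b') (p : a ⟶ b)
      (p' : a' ⟶ b') (q : b' ⟶ c), HEq p p' → HEq (p ≫ eqToHom e ≫ q) (p' ≫ q) := by
    rintro a b _ _ c rfl rfl _ p p' q hp
    rw [eq_of_heq hp]
    simp
  exact key (one_smul G x) (one_smul G y) _ _ _ _ (act_heq_self k 1 rfl f)

instance : Category.{max v w} (QuotCat k G C) where
  Hom α β := QuotHom α β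
  id α := cl (exists_orb α).choose_spec (exists_orb α).choose_spec (𝟙 (exists_orb α).choose)
  comp {α β γ} f g := quotComp α β γ f g
  id_comp {α β} f := by
    refine LinearMap.congr_fun (f := quotComp α α β _) (g := LinearMap.id)
      (quotHom_ext_source (exists_orb α).choose_spec fun hy f => ?_) f
    rw [quotComp_cl_self, Category.id_comp]
    rfl
  comp_id {α β} f := by
    refine LinearMap.congr_fun (f := (quotComp α β β).flip _) (g := LinearMap.id)
      (quotHom_ext fun {x y} hx hy f => ?_) f
    obtain ⟨s, hs⟩ := exists_smul_of_orb (hy.trans (exists_orb β).choose_spec.symm)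
    rw [LinearMap.flip_apply, quotComp_cl _ _ _ _ _ _ s hs, LinearMap.id_apply,
      ← cl_act s hx hy ((orb_smul s x).trans hx) ((orb_smul s y).trans hy) f]
    refine cl_heq _ _ _ _ rfl hs.symm ?_
    rw [Category.comp_id]
    exact comp_eqToHom_heq _ _
  assoc {α β γ δ} f g h := by
    refine LinearMap.congr_fun (f := ((quotComp α γ δ).flip h) ∘ₗ ((quotComp α β γ).flip g))
      (g := (quotComp α β δ).flip (quotComp β γ δ g h)) (quotHom_ext fun {x y} hx hy f => ?_) f
    refine LinearMap.congr_fun (f := ((quotComp α γ δ).flip h) ∘ₗ (quotComp α β γ (cl hx hy f)))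
      (g := (quotComp α β δ (cl hx hy f)) ∘ₗ (quotComp β γ δ).flip h)
      (quotHom_ext_source hy fun {z} hz g => ?_) g
    refine LinearMap.congr_fun (f := quotComp α γ δ (quotComp α β γ (cl hx hy f) (cl hy hz g)))
      (g := (quotComp α β δ (cl hx hy f)) ∘ₗ (quotComp β γ δ (cl hy hz g)))
      (quotHom_ext_source hz fun {w} hw h => ?_) h
    rw [LinearMap.comp_apply, quotComp_cl_self, quotComp_cl_self, quotComp_cl_self,
      quotComp_cl_self, Category.assoc]

instance : Preadditive (QuotCat k G C) where
  homGroup α β := inferInstanceAs (AddCommGroup (QuotHom α β))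
  add_comp α β γ f f' g := LinearMap.map_add₂ (quotComp α β γ) f f' g
  comp_add α β γ f g g' := LinearMap.map_add (quotComp α β γ f) g g'

instance : Linear k (QuotCat k G C) where
  homModule α β := inferInstanceAs (Module k (QuotHom α β))
  smul_comp α β γ r f g := LinearMap.map_smul₂ (quotComp α β γ) r f g
  comp_smul α β γ f r g := LinearMap.map_smul (quotComp α β γ f) r g

variable (k G C) in
/-- The canonical projection, i.e. the Galois covering `C ⟶ C/G`. -/
def galoisCovering : C ⥤ QuotCat k G C where
  obj x := orb k G x
  map f := cl rfl rfl f
  map_id x := by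
    obtain ⟨s, hs⟩ := exists_smul_of_orb (exists_orb (orb k G x)).choose_spec.symm
    refine (cl_act s rfl rfl (orb_smul s x) (orb_smul s x) (𝟙 x)).symm.trans ?_
    rw [KAction.act_id]
    refine cl_heq _ _ _ _ hs hs ?_
    rw [hs]
  map_comp f g := (quotComp_cl_self rfl rfl rfl f g).symm

end Quotient

section Grading

/-- A grading of the `k`-category `B` by the group `G`: each space of morphisms is the direct sum
of subspaces of morphisms of degree `s`, for `s` in `G`, and if `f` and `g` have degrees `s` and
`t` then the composite "`f`, then `g`" has degree `t * s`. (That identities have degree `1` is a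
consequence.) -/
structure Grading (k : Type u) [Field k] (G : Type u₁) [Group G] (B : Type w)
    [Category.{v} B] [Preadditive B] [Linear k B] where
  /-- the morphisms of degree `s` -/
  piece : G → ∀ x y : B, Submodule k (x ⟶ y)
  independent : ∀ x y : B, iSupIndep fun s => piece s x y
  iSup_eq_top : ∀ x y : B, ⨆ s, piece s x y = ⊤
  comp_mem : ∀ {s t : G} {x y z : B} {f : x ⟶ y} {g : y ⟶ z}, f ∈ piece s x y →
    g ∈ piece t y z → f ≫ g ∈ piece (t * s) x z
  id_mem : ∀ x : B, 𝟙 x ∈ piece 1 x x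

section TrivialClass

variable {k : Type u} [Field k] {G : Type u₁} [Group G] {B : Type w}
  [Category.{v} B] [Preadditive B] [Linear k B] (Γ : Grading k G B)

/-- The cochains `φ` of the trivial conjugacy class, i.e. those that are sums of homogeneous
components of types `(s_n, …, s_1, s_0)` with `s_n ⋯ s_1 s_0⁻¹ = 1`: if `f_i` has degree `s_i` for
all `i`, then `φ(f_n, …, f_1)` has degree `s_n ⋯ s_1`. -/
def trivialClassCochains (n : ℕ) : Submodule k (Cochain k B n) where
  carrier := {φ | ∀ (x : Fin (n + 1) → B) (f : ∀ i : Fin n, x i.castSucc ⟶ x i.succ)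
    (s : Fin n → G), (∀ i, f i ∈ Γ.piece (s i) (x i.castSucc) (x i.succ)) →
      φ x f ∈ Γ.piece (List.ofFn s).reverse.prod (x 0) (x (Fin.last n))}
  add_mem' h h' x f s hf := Submodule.add_mem _ (h x f s hf) (h' x f s hf)
  zero_mem' x f s hf := Submodule.zero_mem _
  smul_mem' c φ h x f s hf := Submodule.smul_mem _ c (h x f s hf)

theorem exists_potential {n : ℕ} (s : Fin n → G) :
    ∃ t : Fin (n + 1) → G, (∀ i : Fin n, s i = t i.succ * (t i.castSucc)⁻¹) ∧ t 0 = 1 := by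
  refine ⟨fun i => (Fin.partialProd (fun i => (s i)⁻¹) i)⁻¹, fun i => ?_, ?_⟩
  · have h := Fin.partialProd_succ (fun i => (s i)⁻¹) i
    dsimp only at h ⊢
    rw [h]
    group
  · simp

theorem prod_potential : ∀ {n : ℕ} (t : Fin (n + 1) → G),
    (List.ofFn fun i : Fin n => t i.succ * (t i.castSucc)⁻¹).reverse.prod =
      t (Fin.last n) * (t 0)⁻¹
  | 0, t => by simp
  | n + 1, t => by
    rw [List.ofFn_succ, List.reverse_cons, List.prod_append]
    have h := prod_potential fun i => t i.succ
    simp only [Fin.succ_castSucc] at h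
    rw [h]
    simp

theorem mem_trivialClass_iff {n : ℕ} (φ : Cochain k B n) :
    φ ∈ trivialClassCochains Γ n ↔ ∀ (x : Fin (n + 1) → B)
      (f : ∀ i : Fin n, x i.castSucc ⟶ x i.succ) (t : Fin (n + 1) → G),
      (∀ i, f i ∈ Γ.piece (t i.succ * (t i.castSucc)⁻¹) (x i.castSucc) (x i.succ)) →
      φ x f ∈ Γ.piece (t (Fin.last n) * (t 0)⁻¹) (x 0) (x (Fin.last n)) := by
  constructor
  · intro h x f t hf
    have := h x f _ hf
    rwa [prod_potential] at this
  · intro h x f s hf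
    obtain ⟨t, ht, -⟩ := exists_potential s
    obtain rfl : s = fun i => t i.succ * (t i.castSucc)⁻¹ := funext ht
    rw [prod_potential]
    exact h x f t hf

theorem edge_mem {n : ℕ} (x : Fin (n + 1) → B) (f : ∀ i : Fin n, x i.castSucc ⟶ x i.succ)
    (t : Fin (n + 1) → G)
    (hf : ∀ i, f i ∈ Γ.piece (t i.succ * (t i.castSucc)⁻¹) (x i.castSucc) (x i.succ))
    {a b : Fin (n + 1)} (hab : a ≤ b) :
    edge x f hab ∈ Γ.piece (t b * (t a)⁻¹) (x a) (x b) := by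
  induction b using Fin.induction with
  | zero =>
    obtain rfl : a = 0 := le_antisymm hab (Fin.zero_le _)
    rw [edge_self, mul_inv_cancel]
    exact Γ.id_mem _
  | succ j ih =>
    rcases hab.lt_or_eq with hlt | heq
    · have haj : a ≤ j.castSucc := Fin.le_castSucc_iff.2 hlt
      rw [← edge_comp x f haj j.castSucc_le_succ, edge_succ]
      have := Γ.comp_mem (ih haj) (hf j)
      rwa [mul_assoc, inv_mul_cancel_left] at this
    · subst heq
      rw [edge_self, mul_inv_cancel]
      exact Γ.id_mem _

theorem eval_mem {n N : ℕ} {φ : Cochain k B n} (hφ : φ ∈ trivialClassCochains Γ n)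
    (x : Fin (N + 1) → B) (f : ∀ i : Fin N, x i.castSucc ⟶ x i.succ) (t : Fin (N + 1) → G)
    (hf : ∀ i, f i ∈ Γ.piece (t i.succ * (t i.castSucc)⁻¹) (x i.castSucc) (x i.succ))
    (σ : Fin (n + 1) →o Fin (N + 1)) (a b : Fin (N + 1)) (ha : a ≤ σ 0)
    (hb : σ (Fin.last n) ≤ b) :
    φ.eval x f σ a b ha hb ∈ Γ.piece (t b * (t a)⁻¹) (x a) (x b) := by
  have h := (mem_trivialClass_iff Γ φ).1 hφ (fun i => x (σ i))
    (fun i => edge x f (σ.monotone i.castSucc_le_succ)) (fun i => t (σ i))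
    fun i => edge_mem Γ x f t hf _
  have h' := Γ.comp_mem (edge_mem Γ x f t hf ha) (Γ.comp_mem h (edge_mem Γ x f t hf hb))
  have e : t b * (t (σ (Fin.last n)))⁻¹ * (t (σ (Fin.last n)) * (t (σ 0))⁻¹) *
    (t (σ 0) * (t a)⁻¹) = t b * (t a)⁻¹ := by group
  rw [e] at h'
  exact h'

/-- The differential graded algebra of the cochains of the trivial conjugacy class. -/
def trivialClass : SubDGA k B where
  carrier := trivialClassCochains Γ
  d_mem {n φ} hφ := by
    refine (mem_trivialClass_iff Γ _).2 fun x f t hf => ?_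
    rw [d_apply]
    exact Submodule.sum_mem _ fun i _ => Submodule.smul_mem _ _ (eval_mem Γ hφ x f t hf _ _ _ _ _)
  cup_mem {m n ψ φ} hψ hφ := by
    refine (mem_trivialClass_iff Γ _).2 fun x f t hf => ?_
    rw [cup_apply]
    have h := Γ.comp_mem (eval_mem Γ hφ x f t hf (block n (m + n) 0 (by omega)) 0 ⟨n, by omega⟩
      (Fin.zero_le _) (by simp [block])) (eval_mem Γ hψ x f t hf (block m (m + n) n (by omega))
        ⟨n, by omega⟩ (Fin.last _) (Fin.le_def.2 (Nat.le_add_right _ _)) (Fin.le_last _))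
    rwa [mul_assoc, inv_mul_cancel_left] at h
  one_mem := fun x f s _ => by
    simpa [one] using Γ.id_mem (x 0)

end TrivialClass

section QuotGrading

/-- A transversal of the action: a set of objects that has exactly one element in each orbit. -/
structure Transversal (k : Type u) (G : Type u₁) [Group G] (C : Type w) [MulAction G C] where
  /-- the set of objects -/
  carrier : Set C
  existsUnique : ∀ α : QuotCat k G C, ∃! u, u ∈ carrier ∧ orb k G u = α

variable {k : Type u} [Field k] {G : Type u₁} [Group G] {C : Type w}
  [Category.{v} C] [Preadditive C] [Linear k C] [MulAction G C] [KAction k G C]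

/-- The element of the transversal in the orbit `α`. -/
def Transversal.rep {C : Type w} [MulAction G C] (T : Transversal k G C) (α : QuotCat k G C) : C :=
  (T.existsUnique α).choose

theorem Transversal.orb_rep {C : Type w} [MulAction G C] (T : Transversal k G C)
    (α : QuotCat k G C) : orb k G (T.rep α) = α :=
  (T.existsUnique α).choose_spec.1.2

variable [FreeOnObjects G C] (T : Transversal k G C)

/-- The element `s` of `G` with `s • T.rep α = x`, for `x` in `α`. -/
def Transversal.elt {C : Type w} [MulAction G C] (T : Transversal k G C) {α : QuotCat k G C} {x : C}
    (hx : orb k G x = α) : G :=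
  (exists_smul_of_orb ((T.orb_rep α).trans hx.symm)).choose

theorem Transversal.elt_smul {C : Type w} [MulAction G C] (T : Transversal k G C)
    {α : QuotCat k G C} {x : C} (hx : orb k G x = α) : T.elt hx • T.rep α = x :=
  (exists_smul_of_orb ((T.orb_rep α).trans hx.symm)).choose_spec

theorem Transversal.elt_eq {α : QuotCat k G C} {x : C}
    (hx : orb k G x = α) {s : G} (hs : s • T.rep α = x) : T.elt hx = s :=
  smul_unique (T.elt_smul hx) hs

/-- The morphisms of degree `s` from `α` to `β` in the quotient category: the classes of the
morphisms from `s u` to `v`, where `u` and `v` are the elements of the transversal in `α`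
and `β`. -/
def gradedPiece (s : G) (α β : QuotCat k G C) : Submodule k (α ⟶ β) :=
  LinearMap.range (cl (k := k) (α := α) (β := β) ((orb_smul s (T.rep α)).trans (T.orb_rep α))
    (T.orb_rep β))

/-- The component of degree `s` of a morphism from `α` to `β` in the quotient category, as a
morphism of `C`. -/
def component (s : G) (α β : QuotCat k G C) :
    QuotHom α β →ₗ[k] (s • T.rep α ⟶ T.rep β) := by
  classical
  exact quotLift
    (fun {x y} hx hy =>
      if h : s • T.rep α = (T.elt hy)⁻¹ • x then
        Linear.leftComp k _ (eqToHom h) ∘ₗ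
          Linear.rightComp k _ (eqToHom (inv_smul_eq_iff.2 (T.elt_smul hy).symm)) ∘ₗ
            act k (T.elt hy)⁻¹
      else 0)
    (fun t x y hx hy f => by
      have e : T.elt ((orb_smul t y).trans hy) = t * T.elt hy :=
        T.elt_eq _ (by rw [mul_smul, T.elt_smul])
      have e' : (T.elt ((orb_smul t y).trans hy))⁻¹ * t = (T.elt hy)⁻¹ := by rw [e]; group
      have e2 : (T.elt ((orb_smul t y).trans hy))⁻¹ • t • x = (T.elt hy)⁻¹ • x := by
        rw [← mul_smul, e']
      by_cases h : s • T.rep α = (T.elt hy)⁻¹ • x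
      · rw [dif_pos h, dif_pos (h.trans e2.symm)]
        refine eq_of_heq ((eqToHom_conj_heq _ _ _).trans
          (HEq.trans ?_ (eqToHom_conj_heq _ _ _).symm))
        exact act_act_heq k _ _ _ e' f
      · rw [dif_neg h, dif_neg fun h' => h (h'.trans e2)]
        rfl)

theorem elt_rep (β : QuotCat k G C) : T.elt (T.orb_rep β) = 1 :=
  T.elt_eq _ (one_smul G _)

theorem component_self (s : G) (α β : QuotCat k G C) (f : s • T.rep α ⟶ T.rep β) :
    component T s α β (cl ((orb_smul s (T.rep α)).trans (T.orb_rep α)) (T.orb_rep β) f) = f := by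
  rw [component, quotLift_cl, dif_pos (by rw [elt_rep, inv_one, one_smul])]
  refine eq_of_heq ((eqToHom_conj_heq _ _ _).trans ?_)
  exact act_heq_self k _ (by rw [elt_rep, inv_one]) f

theorem component_of_ne {s t : G} (hst : t ≠ s) (α β : QuotCat k G C)
    (f : t • T.rep α ⟶ T.rep β) :
    component T s α β (cl ((orb_smul t (T.rep α)).trans (T.orb_rep α)) (T.orb_rep β) f) = 0 := by
  rw [component, quotLift_cl, dif_neg, LinearMap.zero_apply]
  rw [elt_rep, inv_one, one_smul]
  exact fun h => hst (smul_unique rfl h)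

theorem cl_mem_gradedPiece {α β : QuotCat k G C} {x y : C} (hx : orb k G x = α)
    (hy : orb k G y = β) (f : x ⟶ y) :
    cl hx hy f ∈ gradedPiece T ((T.elt hy)⁻¹ * T.elt hx) α β := by
  have ex : ((T.elt hy)⁻¹ * T.elt hx) • T.rep α = (T.elt hy)⁻¹ • x := by
    rw [mul_smul, T.elt_smul]
  have ey : (T.elt hy)⁻¹ • y = T.rep β := inv_smul_eq_iff.2 (T.elt_smul hy).symm
  refine ⟨eqToHom ex ≫ act k (T.elt hy)⁻¹ f ≫ eqToHom ey, ?_⟩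
  rw [← cl_act (T.elt hy)⁻¹ hx hy ((orb_smul _ x).trans hx) ((orb_smul _ y).trans hy) f]
  exact cl_heq _ _ _ _ ex ey.symm (eqToHom_conj_heq _ _ _)

variable (k G C) in
/-- The grading of the quotient category determined by a transversal. -/
def quotGrading : Grading k G (QuotCat k G C) where
  piece := gradedPiece T
  independent α β := by
    rw [iSupIndep_def]
    intro s
    rw [Submodule.disjoint_def]
    rintro _ ⟨f, rfl⟩ hf
    have hle : ⨆ t, ⨆ (_ : t ≠ s), gradedPiece T t α β ≤ LinearMap.ker (component T s α β) := by
      refine iSup₂_le fun t ht => ?_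
      rintro _ ⟨g, rfl⟩
      exact component_of_ne T ht α β g
    have h0 := hle hf
    have h1 : f = 0 := (component_self T s α β f).symm.trans h0
    rw [h1]
    exact map_zero _
  iSup_eq_top α β := by
    rw [← Submodule.ker_mkQ (⨆ s, gradedPiece T s α β), LinearMap.ker_eq_top]
    refine quotHom_ext fun hx hy f => ?_
    exact (Submodule.Quotient.mk_eq_zero _).2
      (le_iSup (fun s => gradedPiece T s α β) _ (cl_mem_gradedPiece T hx hy f))
  comp_mem {s t α β γ} := by
    rintro _ _ ⟨f, rfl⟩ ⟨g, rfl⟩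
    have h := quotComp_cl ((orb_smul s (T.rep α)).trans (T.orb_rep α)) (T.orb_rep β)
      ((orb_smul t (T.rep β)).trans (T.orb_rep β)) (T.orb_rep γ) f g t rfl
    refine ⟨eqToHom (mul_smul t s _) ≫ act k t f ≫ eqToHom rfl ≫ g, ?_⟩
    refine Eq.trans ?_ h.symm
    exact cl_heq _ _ _ _ (mul_smul t s _) rfl (eqToHom_comp_heq _ _)
  id_mem α := by
    have hx := (exists_orb α).choose_spec
    have h := cl_mem_gradedPiece T hx hx (𝟙 _)
    rw [inv_mul_cancel] at h
    exact h

end QuotGrading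

/-- The differential graded algebra of the cochains of the trivial conjugacy class of `C/G`, graded
by means of the transversal `T`. -/
def quotTrivialClass (k : Type u) [Field k] (G : Type u₁) [Group G] (C : Type w) [Category.{v} C]
    [Preadditive C] [Linear k C] [MulAction G C] [KAction k G C] [FreeOnObjects G C]
    (T : Transversal k G C) : SubDGA k (QuotCat k G C) :=
  trivialClass (quotGrading k G C T)

end Grading
end

end HochschildMitchell

/-! Let $x = t u_\alpha$ and $y = t' u_\beta$ be objects of `C`. Because the action on objects is
free, `cl` maps $C(x,y)$ bijectively onto the morphisms $\alpha \to \beta$ of degree $t'^{-1}t$ in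
the quotient (`cl_injective`, `mem_gradedPiece_iff`), and it is compatible with composition. Along a
path $x_0 \to \dots \to x_n$ of `C` these degrees telescope. So a cochain $\psi$ of the trivial
class sends the classes of the $f_i$ to a morphism of exactly the degree that lifts, uniquely, to
$x_0 \to x_n$; this lift is the value of `liftCochain` on the $f_i$, characterized by
`cl_liftCochain`. Since $sf$ and $f$ have the same class, the lifted cochain is invariant. Since
`cl` is functorial and injective, lifting respects coboundary, cup product and unit.

Conversely, every sequence of homogeneous morphisms of the quotient is the sequence of classes of a
path of `C` (`exists_composable_lift`). As homogeneous morphisms span, a cochain of the quotient is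
determined by its values on such sequences (`quotCochain_ext`), which makes lifting injective on the
trivial class. For surjectivity, an invariant cochain is evaluated on a lifted path and the class of
the value is taken. Two lifts of one sequence that have the same degrees differ by a single group
element, so invariance removes the choice (`descend_cl`). Lifting is therefore an isomorphism of
differential graded algebras from the trivial class to the invariant cochains.

For the second isomorphism, exactness of invariants applied to the augmentation $k[G] \to k$ yields
an invariant element of augmentation 1. Its coefficients are all equal, so $G$ is finite of order
invertible in $k$ (`InvariantsExact.finite_and_card_ne_zero`). Averaging over $G$ then commutes with
the coboundary, and identifies the cohomology of the invariant cochains with the invariants of the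
cohomology. The identification is induced by an inclusion of algebras, hence multiplicative. -/

namespace HochschildMitchell

noncomputable section

/-! ### Homomorphisms of differential graded algebras of cochains and their action on cohomology. -/

section DGAHom

universe v' w'

variable {k : Type u} [Field k] {B : Type w} [Category.{v} B] [Preadditive B] [Linear k B]
  {B' : Type w'} [Category.{v'} B'] [Preadditive B'] [Linear k B']

/-- A family of linear maps on cochains that restricts to a homomorphism of differential graded
algebras from `S` to `S'`. -/
structure SubDGA.Hom (S : SubDGA k B) (S' : SubDGA k B') where
  /-- the maps on cochains -/
  map : ∀ n, Cochain k B n →ₗ[k] Cochain k B' n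
  map_mem : ∀ {n} {φ : Cochain k B n}, φ ∈ S.carrier n → map n φ ∈ S'.carrier n
  map_d : ∀ {n} {φ : Cochain k B n}, φ ∈ S.carrier n → map (n + 1) (d n φ) = d n (map n φ)
  map_cup : ∀ {m n} {ψ : Cochain k B m} {φ : Cochain k B n}, ψ ∈ S.carrier m → φ ∈ S.carrier n →
    map (m + n) (cup m n ψ φ) = cup m n (map m ψ) (map n φ)
  map_one : map 0 one = one

namespace SubDGA

theorem toClass_surjective (S : SubDGA k B) (n : ℕ) : Function.Surjective (S.toClass n) :=
  Submodule.mkQ_surjective _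

theorem toClass_eq_zero_iff (S : SubDGA k B) {n : ℕ} (φ : S.cocycles n) :
    S.toClass n φ = 0 ↔ φ.1 ∈ S.coboundaries n :=
  Submodule.Quotient.mk_eq_zero _

namespace Hom

variable {S : SubDGA k B} {S' : SubDGA k B'} (F : S.Hom S')

theorem map_mem_cocycles {n : ℕ} {φ : Cochain k B n} (hφ : φ ∈ S.cocycles n) :
    F.map n φ ∈ S'.cocycles n := by
  refine ⟨F.map_mem hφ.1, ?_⟩
  have h : d n φ = 0 := hφ.2
  change d n (F.map n φ) = 0
  rw [← F.map_d hφ.1, h, map_zero]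

theorem map_mem_coboundaries :
    ∀ {n : ℕ} {φ : Cochain k B n}, φ ∈ S.coboundaries n → F.map n φ ∈ S'.coboundaries n
  | 0, φ, hφ => by
    obtain rfl : φ = 0 := hφ
    rw [map_zero]
    exact zero_mem _
  | n + 1, _, ⟨χ, hχ, rfl⟩ => ⟨F.map n χ, F.map_mem hχ, (F.map_d hχ).symm⟩

/-- The map on cocycles. -/
def onCocycles (n : ℕ) : S.cocycles n →ₗ[k] S'.cocycles n :=
  (F.map n).restrict fun _ => F.map_mem_cocycles

/-- The map induced on cohomology. -/
def onCohomology (n : ℕ) : S.Cohomology n →ₗ[k] S'.Cohomology n :=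
  Cohomology.lift S (S'.toClass n ∘ₗ F.onCocycles n) fun _ hφ =>
    S'.toClass_eq_zero _ (F.map_mem_coboundaries hφ)

theorem onCohomology_toClass {n : ℕ} (φ : S.cocycles n) :
    F.onCohomology n (S.toClass n φ) = S'.toClass n (F.onCocycles n φ) := rfl

theorem onCohomology_hone : F.onCohomology 0 S.hone = S'.hone :=
  congrArg (S'.toClass 0) (Subtype.ext F.map_one)

theorem onCohomology_hcup {m n : ℕ} (a : S.Cohomology m) (b : S.Cohomology n) :
    F.onCohomology (m + n) (S.hcup m n a b) =
      S'.hcup m n (F.onCohomology m a) (F.onCohomology n b) := by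
  obtain ⟨ψ, rfl⟩ := S.toClass_surjective m a
  obtain ⟨φ, rfl⟩ := S.toClass_surjective n b
  exact congrArg (S'.toClass (m + n)) (Subtype.ext (F.map_cup ψ.2.1 φ.2.1))

/-- A homomorphism that is bijective on cochains is bijective on cohomology. -/
theorem onCohomology_bijective
    (hinj : ∀ {n} {φ : Cochain k B n}, φ ∈ S.carrier n → F.map n φ = 0 → φ = 0)
    (hsurj : ∀ {n} {ψ : Cochain k B' n}, ψ ∈ S'.carrier n → ∃ φ ∈ S.carrier n, F.map n φ = ψ)
    (n : ℕ) : Function.Bijective (F.onCohomology n) := by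
  constructor
  · rw [injective_iff_map_eq_zero]
    intro a ha
    obtain ⟨φ, rfl⟩ := S.toClass_surjective n a
    have h : F.map n φ.1 ∈ S'.coboundaries n := (S'.toClass_eq_zero_iff _).1 ha
    refine S.toClass_eq_zero _ ?_
    cases n with
    | zero => exact hinj φ.2.1 h
    | succ n =>
      -- The primitive of the image comes from some `χ` in `S`; then `φ - dχ` is a cochain of `S`
      -- with image zero, so `φ = dχ`.
      obtain ⟨χ', hχ', h⟩ := h
      obtain ⟨χ, hχ, rfl⟩ := hsurj hχ'
      refine ⟨χ, hχ, (sub_eq_zero.1 (hinj (sub_mem φ.2.1 (S.d_mem hχ)) ?_)).symm⟩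
      rw [map_sub, F.map_d hχ, h, sub_self]
  · intro b
    obtain ⟨ψ, rfl⟩ := S'.toClass_surjective n b
    obtain ⟨φ, hφ, h⟩ := hsurj ψ.2.1
    -- A preimage of a cocycle is a cocycle, by injectivity one degree higher.
    have hd : d n φ = 0 := by
      refine hinj (S.d_mem hφ) ?_
      rw [F.map_d hφ, h]
      exact ψ.2.2
    exact ⟨S.toClass n ⟨φ, hφ, hd⟩, congrArg (S'.toClass n) (Subtype.ext h)⟩

end Hom

end SubDGA

end DGAHom

/-! ### Exactness of invariants, and averaging over the group. -/

section Averaging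

/-- If the invariants functor is exact, then `G` is finite and its order is invertible in `k`: the
exactness gives an invariant element of `k[G]` of augmentation `1`. -/
theorem InvariantsExact.finite_and_card_ne_zero {k : Type u} [Field k] {G : Type u₁} [Group G]
    (h : InvariantsExact k G) : Finite G ∧ (Nat.card G : k) ≠ 0 := by
  -- The augmentation of `k[G]`. The lifted copy of `k` lies in the same universe as `k[G]`, the one
  -- to which `InvariantsExact` refers.
  let ε : Rep.leftRegular k G ⟶ Rep.trivial k G (ULift.{u₁} k) := Rep.leftRegularHom _ (ULift.up 1)
  have hε : Function.Surjective ε.hom := fun c =>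
    ⟨.single 1 c.down, (Rep.leftRegularHom_hom_single _ _ _).trans (ULift.ext _ _ (mul_one _))⟩
  have : Epi ε := (Rep.epi_iff_surjective ε).2 hε
  have hS : (ShortComplex.mk (Limits.kernel.ι ε) ε (Limits.kernel.condition ε)).ShortExact :=
    { exact := ShortComplex.exact_kernel ε }
  -- Only right exactness is used: the invariant element 1 of the trivial representation has an
  -- invariant preimage `a`.
  obtain ⟨⟨a, ha⟩, ha'⟩ := (ModuleCat.epi_iff_surjective _).1 (h _ hS).epi_g
    (⟨ULift.up 1, fun _ => rfl⟩ : (Rep.trivial k G (ULift.{u₁} k)).ρ.invariants)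
  have ha1 : ε.hom a = ULift.up 1 := congrArg Subtype.val ha'
  -- The coefficient of `g` in the translate of `a` by `g` is the coefficient of `1` in `a`.
  have hconst : ∀ g, a.coeff g = a.coeff 1 := fun g => by
    have := congrArg (fun b => MonoidAlgebra.coeff b g) (ha g)
    simpa [Representation.coeff_ofMulAction] using this.symm
  have hε' : ∀ b, (ε.hom b).down = b.coeff.sum fun _ r => r := by
    suffices ULift.moduleEquiv.toLinearMap ∘ₗ ε.hom.toLinearMap =
        (Finsupp.lsum k fun _ => LinearMap.id) ∘ₗ (MonoidAlgebra.coeffLinearEquiv k).toLinearMap from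
      LinearMap.congr_fun this
    ext g
    simp [ε]
  have hsum : a.coeff.sum (fun _ r => r) = 1 := (hε' a).symm.trans (congrArg ULift.down ha1)
  have hne : a.coeff 1 ≠ 0 := by
    intro h0
    have : a.coeff = 0 := Finsupp.ext fun g => (hconst g).trans h0
    rw [this, Finsupp.sum_zero_index] at hsum
    exact zero_ne_one hsum
  -- The common coefficient is nonzero, so the finite support of `a` is all of `G`. Afterwards the
  -- augmentation reads `|G| · a(1) = 1`.
  have hfin : Finite G := by
    refine Set.finite_univ_iff.1 (a.coeff.support.finite_toSet.subset fun g _ => ?_)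
    rw [Finset.mem_coe, Finsupp.mem_support_iff, hconst]
    exact hne
  refine ⟨hfin, fun h0 => ?_⟩
  have := Fintype.ofFinite G
  rw [Finsupp.sum_fintype _ _ fun _ => rfl, Finset.sum_congr rfl fun g _ => hconst g,
    Finset.sum_const, Finset.card_univ, ← Nat.card_eq_fintype_card, nsmul_eq_mul, h0,
    zero_mul] at hsum
  exact zero_ne_one hsum

variable {k : Type u} [Field k] {G : Type u₁} [Group G] {C : Type w} [Category.{v} C]
  [Preadditive C] [Linear k C] [MulAction G C] [KAction k G C]

theorem averageMap_apply [Fintype G] [Invertible (Fintype.card G : k)] {V : Type*}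
    [AddCommGroup V] [Module k V] (ρ : Representation k G V) (x : V) :
    ρ.averageMap x = ⅟(Fintype.card G : k) • ∑ s, ρ s x := by
  simp [GroupAlgebra.average]

theorem averageMap_map [Fintype G] [Invertible (Fintype.card G : k)] {V W : Type*}
    [AddCommGroup V] [Module k V] [AddCommGroup W] [Module k W] (ρ : Representation k G V)
    (τ : Representation k G W) (f : V →ₗ[k] W) (hf : ∀ s x, f (ρ s x) = τ s (f x)) (x : V) :
    f (ρ.averageMap x) = τ.averageMap (f x) := by
  rw [averageMap_apply, averageMap_apply, map_smul, map_sum]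
  simp only [hf]

/-- Each group element commutes with the coboundary, hence so does the mean of their actions:
averaging is a cochain map onto the invariant cochains. -/
theorem d_averageMap [Fintype G] [Invertible (Fintype.card G : k)] {n : ℕ} (φ : Cochain k C n) :
    d n ((cochainRep k (G := G) C n).averageMap φ) =
      (cochainRep k (G := G) C (n + 1)).averageMap (d n φ) :=
  averageMap_map (cochainRep k (G := G) C n) (cochainRep k (G := G) C (n + 1)) (d n)
    (fun s φ => d_actCochain s φ) φ

variable (k G C)

/-- The inclusion of the invariant cochains. -/
def invariantInclusion : (invariantCochains k G C).Hom (SubDGA.all k C) where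
  map _ := LinearMap.id
  map_mem _ := Submodule.mem_top
  map_d _ := rfl
  map_cup _ _ := rfl
  map_one := rfl

variable {k G C}

theorem invariantInclusion_onCohomology_mem {n : ℕ} (c : (invariantCochains k G C).Cohomology n) :
    (invariantInclusion k G C).onCohomology n c ∈ (cohomologyRep k G C n).invariants := by
  obtain ⟨φ, rfl⟩ := SubDGA.toClass_surjective _ n c
  exact fun s => congrArg ((SubDGA.all k C).toClass n) (Subtype.ext (φ.2.1 s))

/-- An invariant cocycle equals its own average. If it is the coboundary of some `χ`, it is
therefore also the coboundary of the average of `χ`, which is invariant. -/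
theorem invariantInclusion_onCohomology_injective (h : InvariantsExact k G) (n : ℕ) :
    Function.Injective ((invariantInclusion k G C).onCohomology n) := by
  obtain ⟨hfin, hne⟩ := h.finite_and_card_ne_zero
  have := Fintype.ofFinite G
  rw [Nat.card_eq_fintype_card] at hne
  have := invertibleOfNonzero hne
  rw [injective_iff_map_eq_zero]
  intro a ha
  obtain ⟨φ, rfl⟩ := SubDGA.toClass_surjective _ n a
  have h : φ.1 ∈ (SubDGA.all k C).coboundaries n := (SubDGA.toClass_eq_zero_iff _ _).1 ha
  refine SubDGA.toClass_eq_zero _ _ ?_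
  cases n with
  | zero => exact h
  | succ n =>
    obtain ⟨χ, -, h⟩ := h
    refine ⟨_, (cochainRep k (G := G) C n).averageMap_invariant χ, ?_⟩
    rw [d_averageMap, h]
    exact (cochainRep k (G := G) C (n + 1)).averageMap_id _ φ.2.1

/-- Averaging a representing cocycle gives an invariant cocycle, whose class is the average of the
translates of `c`. These are all equal to `c`. -/
theorem exists_invariantInclusion_onCohomology_eq (h : InvariantsExact k G) {n : ℕ} {c : HH k C n}
    (hc : c ∈ (cohomologyRep k G C n).invariants) :
    ∃ a, (invariantInclusion k G C).onCohomology n a = c := by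
  obtain ⟨hfin, hne⟩ := h.finite_and_card_ne_zero
  have := Fintype.ofFinite G
  rw [Nat.card_eq_fintype_card] at hne
  have := invertibleOfNonzero hne
  obtain ⟨φ, rfl⟩ := SubDGA.toClass_surjective _ n c
  have hφ : d n φ.1 = 0 := φ.2.2
  refine ⟨SubDGA.toClass _ n ⟨_, (cochainRep k (G := G) C n).averageMap_invariant φ.1, ?_⟩, ?_⟩
  · change d n _ = 0
    rw [d_averageMap, hφ, map_zero]
  · refine Eq.trans ?_ ((cohomologyRep k G C n).averageMap_id _ hc)
    refine Eq.trans ?_ (averageMap_apply _ _).symm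
    -- The average is rewritten as a linear combination of cocycles, so that the linear map
    -- `toClass` can be applied term by term.
    refine Eq.trans (congrArg ((SubDGA.all k C).toClass n) (Subtype.ext (a2 :=
      ⅟(Fintype.card G : k) • ∑ s : G, actCocycles k s n φ) ?_)) ?_
    · rw [Submodule.coe_smul, Submodule.coe_sum]
      exact averageMap_apply _ _
    · rw [map_smul, map_sum]
      rfl

end Averaging

end

end HochschildMitchell

namespace HochschildMitchell

noncomputable section

/-! ### Unique lifting of homogeneous morphisms along the Galois covering. -/

section Covering

variable {k : Type u} [Field k] {G : Type u₁} [Group G] {C : Type w}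
  [Category.{v} C] [Preadditive C] [Linear k C] [MulAction G C] [KAction k G C]
  [FreeOnObjects G C] (T : Transversal k G C)

/-- The morphism `x ⟶ y` of which the component of degree `(T.elt hy)⁻¹ * T.elt hx` of a morphism
of the quotient category is the class. -/
def Transversal.lift {α β : QuotCat k G C} {x y : C} (hx : orb k G x = α) (hy : orb k G y = β) :
    (α ⟶ β) →ₗ[k] (x ⟶ y) :=
  Linear.leftComp k _ (eqToHom (by rw [mul_smul, smul_inv_smul, T.elt_smul] :
      x = T.elt hy • ((T.elt hy)⁻¹ * T.elt hx) • T.rep α)) ∘ₗ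
    Linear.rightComp k _ (eqToHom (T.elt_smul hy)) ∘ₗ act k (T.elt hy) ∘ₗ
      component T ((T.elt hy)⁻¹ * T.elt hx) α β

/-- Strips the identifications of objects, so that the laws of the action, which are heterogeneous
equalities, can be applied. -/
theorem Transversal.lift_heq {α β : QuotCat k G C} {x y : C} (hx : orb k G x = α)
    (hy : orb k G y = β) (h : α ⟶ β) :
    HEq (T.lift hx hy h)
      (act k (T.elt hy) (component T ((T.elt hy)⁻¹ * T.elt hx) α β h)) := by
  simp only [Transversal.lift, LinearMap.comp_apply, Linear.leftComp_apply,
    Linear.rightComp_apply]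
  exact eqToHom_conj_heq _ _ _

theorem Transversal.lift_eq_zero {α β : QuotCat k G C} {x y : C} (hx : orb k G x = α)
    (hy : orb k G y = β) {h : α ⟶ β}
    (h0 : component T ((T.elt hy)⁻¹ * T.elt hx) α β h = 0) : T.lift hx hy h = 0 := by
  simp [Transversal.lift, h0]

/-- Translating `f` so that its target becomes the representative of `β` does not change its class.
Its source is then `s • T.rep α` with `s = (T.elt hy)⁻¹ * T.elt hx`, so `component` returns the
translated morphism, and acting by `T.elt hy` brings it back to `f`. -/
theorem Transversal.lift_cl {α β : QuotCat k G C} {x y : C} (hx : orb k G x = α)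
    (hy : orb k G y = β) (f : x ⟶ y) : T.lift hx hy (cl hx hy f) = f := by
  have ex : ((T.elt hy)⁻¹ * T.elt hx) • T.rep α = (T.elt hy)⁻¹ • x := by
    rw [mul_smul, T.elt_smul]
  have ey : (T.elt hy)⁻¹ • y = T.rep β := inv_smul_eq_iff.2 (T.elt_smul hy).symm
  have e : cl hx hy f = cl ((orb_smul _ (T.rep α)).trans (T.orb_rep α)) (T.orb_rep β)
      (eqToHom ex ≫ act k (T.elt hy)⁻¹ f ≫ eqToHom ey) := by
    rw [← cl_act (T.elt hy)⁻¹ hx hy ((orb_smul _ x).trans hx) ((orb_smul _ y).trans hy) f]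
    exact cl_heq _ _ _ _ ex.symm ey (eqToHom_conj_heq _ _ _).symm
  refine eq_of_heq ((T.lift_heq hx hy _).trans ?_)
  rw [e, component_self]
  exact (act_heq k _ ex ey.symm (eqToHom_conj_heq _ _ _)).trans
    (act_act_heq_self k _ _ (mul_inv_cancel _) f)

/-- Identities between morphisms of `C` can thus be checked on classes, where translates coincide
and transports along equalities of objects disappear. -/
theorem cl_injective (T : Transversal k G C) {α β : QuotCat k G C} {x y : C}
    (hx : orb k G x = α) (hy : orb k G y = β) : Function.Injective (cl (k := k) hx hy) :=
  Function.LeftInverse.injective (T.lift_cl hx hy)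

/-- The homogeneous morphisms are the classes of the morphisms of `C` with suitable source and
target. -/
theorem mem_gradedPiece_iff {α β : QuotCat k G C} {x y : C} (hx : orb k G x = α)
    (hy : orb k G y = β) {h : α ⟶ β} :
    h ∈ gradedPiece T ((T.elt hy)⁻¹ * T.elt hx) α β ↔ ∃ f, cl hx hy f = h := by
  refine ⟨?_, ?_⟩
  · rintro ⟨f, rfl⟩
    have ex : x = T.elt hy • ((T.elt hy)⁻¹ * T.elt hx) • T.rep α := by
      rw [mul_smul, smul_inv_smul, T.elt_smul]
    refine ⟨eqToHom ex ≫ act k (T.elt hy) f ≫ eqToHom (T.elt_smul hy), ?_⟩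
    rw [← cl_act (T.elt hy) _ (T.orb_rep β) ((orb_smul _ _).trans
      ((orb_smul _ _).trans (T.orb_rep α))) ((orb_smul _ _).trans (T.orb_rep β)) f]
    exact cl_heq _ _ _ _ ex (T.elt_smul hy).symm (eqToHom_conj_heq _ _ _)
  · rintro ⟨f, rfl⟩
    exact cl_mem_gradedPiece T hx hy f

theorem Transversal.cl_lift {α β : QuotCat k G C} {x y : C} (hx : orb k G x = α)
    (hy : orb k G y = β) {h : α ⟶ β}
    (hh : h ∈ gradedPiece T ((T.elt hy)⁻¹ * T.elt hx) α β) :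
    cl hx hy (T.lift hx hy h) = h := by
  obtain ⟨f, rfl⟩ := (mem_gradedPiece_iff T hx hy).1 hh
  rw [T.lift_cl]

theorem component_eq_zero {s t : G} (hst : t ≠ s) {α β : QuotCat k G C} {h : α ⟶ β}
    (hh : h ∈ gradedPiece T t α β) : component T s α β h = 0 := by
  obtain ⟨f, rfl⟩ := hh
  exact component_of_ne T hst α β f

/-- The morphisms with finitely many nonzero components form a subspace. It contains every
homogeneous morphism, hence is everything. This makes the sum over degrees in `descend` finite. -/
theorem finite_component_ne_zero {α β : QuotCat k G C} (h : α ⟶ β) :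
    {s | component T s α β h ≠ 0}.Finite := by
  have hle : ⨆ s, gradedPiece T s α β ≤
      { carrier := {h : α ⟶ β | {s | component T s α β h ≠ 0}.Finite}
        add_mem' := fun {a b} ha hb => (ha.union hb).subset fun s hs => by
          by_contra! hcon
          simp only [Set.mem_union, Set.mem_ofPred_eq, not_or, not_not] at hcon
          exact hs ((map_add (component T s α β) a b).trans (by rw [hcon.1, hcon.2, add_zero]))
        zero_mem' := Set.finite_empty.subset fun s hs => hs (map_zero (component T s α β))
        smul_mem' := fun c a ha => ha.subset fun s hs h0 =>
          hs ((map_smul (component T s α β) c a).trans (by rw [h0, smul_zero])) } := by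
    refine iSup_le fun t h hh => (Set.finite_singleton t).subset fun s hs => ?_
    by_contra hne
    exact hs (component_eq_zero T (Ne.symm hne) hh)
  exact hle (((quotGrading k G C T).iSup_eq_top α β).ge trivial)

/-- A sequence of homogeneous morphisms of the quotient category lifts to a sequence of composable
morphisms of `C`. -/
theorem exists_composable_lift {n : ℕ} (α : Fin (n + 1) → QuotCat k G C)
    (h : ∀ i : Fin n, α i.castSucc ⟶ α i.succ) (t : Fin (n + 1) → G)
    (hh : ∀ i, h i ∈ gradedPiece T (t i.succ * (t i.castSucc)⁻¹) (α i.castSucc) (α i.succ)) :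
    ∃ (x : Fin (n + 1) → C) (hx : ∀ i, orb k G (x i) = α i)
      (f : ∀ i : Fin n, x i.castSucc ⟶ x i.succ), (∀ i, T.elt (hx i) = (t i)⁻¹) ∧
        ∀ i, cl (hx i.castSucc) (hx i.succ) (f i) = h i := by
  -- The vertex over `α i` is the translate of the representative by `(t i)⁻¹`: classes of morphisms
  -- from vertex `i` to vertex `i + 1` then have degree `t (i + 1) * (t i)⁻¹`, as required of `h i`.
  have hx : ∀ i, orb k G ((t i)⁻¹ • T.rep (α i)) = α i :=
    fun i => (orb_smul _ _).trans (T.orb_rep _)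
  have he : ∀ i, T.elt (hx i) = (t i)⁻¹ := fun i => T.elt_eq _ rfl
  have hf : ∀ i : Fin n, ∃ f, cl (hx i.castSucc) (hx i.succ) f = h i := fun i => by
    refine (mem_gradedPiece_iff T _ _).1 ?_
    rw [he, he, inv_inv]
    exact hh i
  choose f hf using hf
  exact ⟨_, hx, f, he, hf⟩

/-- Cochains of the quotient category that agree on the sequences of the classes of composable
morphisms of `C` are equal. -/
theorem quotCochain_ext (T : Transversal k G C) {n : ℕ} {ψ ψ' : Cochain k (QuotCat k G C) n}
    (H : ∀ (x : Fin (n + 1) → C) (f : ∀ i : Fin n, x i.castSucc ⟶ x i.succ),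
      ψ (fun i => orb k G (x i)) (fun i => cl rfl rfl (f i)) =
        ψ' (fun i => orb k G (x i)) (fun i => cl rfl rfl (f i))) : ψ = ψ' := by
  funext α
  -- Multilinear maps are compared on homogeneous arguments, which span each space of morphisms; an
  -- index of the spanning family is a degree together with a morphism of that degree.
  refine MultilinearMap.ext_of_span_eq_top
    (γ := fun i : Fin n => Σ s : G, gradedPiece T s (α i.castSucc) (α i.succ))
    (g := fun i j => j.2.1) (fun i => ?_) fun j => ?_
  · rw [eq_top_iff, ← (quotGrading k G C T).iSup_eq_top]
    exact iSup_le fun s h hh => Submodule.subset_span ⟨⟨s, h, hh⟩, rfl⟩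
  -- Arbitrary degrees are quotients of successive terms of some sequence `t`, so the homogeneous
  -- arguments lift to a path of `C`.
  · obtain ⟨t, ht, -⟩ := exists_potential fun i => (j i).1
    obtain ⟨x, hx, f, -, hf⟩ := exists_composable_lift T α (fun i => (j i).2.1) t
      fun i => ht i ▸ (j i).2.2
    obtain rfl : (fun i => orb k G (x i)) = α := funext hx
    rw [← funext hf]
    exact H x f

/-! ### Lifting the cochains of the trivial class to invariant cochains. -/

theorem cl_comp {x y z : C} (f : x ⟶ y) (g : y ⟶ z) :
    cl (k := k) (G := G) rfl rfl (f ≫ g) =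
      (show orb k G x ⟶ orb k G y from cl rfl rfl f) ≫
        (show orb k G y ⟶ orb k G z from cl rfl rfl g) :=
  (galoisCovering k G C).map_comp f g

theorem edge_cl {n : ℕ} (x : Fin (n + 1) → C) (f : ∀ i : Fin n, x i.castSucc ⟶ x i.succ)
    {a b : Fin (n + 1)} (hab : a ≤ b) :
    edge (B := QuotCat k G C) (fun i => orb k G (x i)) (fun i => cl rfl rfl (f i)) hab =
      cl rfl rfl (edge x f hab) := by
  refine edge_unique (B := QuotCat k G C) (fun i => orb k G (x i)) _
    (fun _ _ h => cl rfl rfl (edge x f h)) (fun a => ?_) (fun a j h => ?_) hab (fun i _ _ => ?_)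
  · rw [edge_self]
    exact (galoisCovering k G C).map_id (x a)
  · rw [← edge_comp x f h j.castSucc_le_succ]
    exact cl_comp _ _
  · rw [edge_succ]

/-- The cochain of `C` of which the value on `f` is the lift of the value of `ψ` on the classes of
`f`. -/
def liftCochain (n : ℕ) : Cochain k (QuotCat k G C) n →ₗ[k] Cochain k C n where
  toFun ψ x := (T.lift rfl rfl).compMultilinearMap
    ((ψ fun i => orb k G (x i)).compLinearMap fun _ => cl rfl rfl)
  map_add' ψ ψ' := by
    funext x
    ext f
    exact map_add (T.lift rfl rfl) _ _
  map_smul' c ψ := by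
    funext x
    ext f
    exact map_smul (T.lift rfl rfl) _ _

/-- The class of `f i` has degree `t (i + 1) * (t i)⁻¹`, where `t i` is the inverse of the element
of `G` carrying the representative to `x i`. Membership in the trivial class puts the value of `ψ`
in degree `t n * (t 0)⁻¹`, the degree of the classes of morphisms from `x 0` to `x n`, so passing to
the lift loses nothing. The orbits `α i` are kept variable because those of `s • x i` and `x i` are
only propositionally equal. -/
theorem cl_liftCochain {n : ℕ} {ψ : Cochain k (QuotCat k G C) n}
    (hψ : ψ ∈ (quotTrivialClass k G C T).carrier n) {α : Fin (n + 1) → QuotCat k G C}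
    (x : Fin (n + 1) → C) (hx : ∀ i, orb k G (x i) = α i)
    (f : ∀ i : Fin n, x i.castSucc ⟶ x i.succ) :
    cl (hx 0) (hx (Fin.last n)) (liftCochain T n ψ x f) =
      ψ α fun i => cl (hx i.castSucc) (hx i.succ) (f i) := by
  obtain rfl : (fun i => orb k G (x i)) = α := funext hx
  refine T.cl_lift rfl rfl ?_
  have h := (mem_trivialClass_iff (quotGrading k G C T) ψ).1 hψ (fun i => orb k G (x i))
    (fun i => cl rfl rfl (f i)) (fun i => (T.elt (α := orb k G (x i)) rfl)⁻¹) fun i => by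
      rw [inv_inv]
      exact cl_mem_gradedPiece T rfl rfl (f i)
  rw [inv_inv] at h
  exact h

/-- Follows from the previous characterization by functoriality of `cl`. The terms of the coboundary
and the factors of the cup product are all of the form `eval`, so this covers both. -/
theorem cl_eval_liftCochain {n N : ℕ} {ψ : Cochain k (QuotCat k G C) n}
    (hψ : ψ ∈ (quotTrivialClass k G C T).carrier n) (x : Fin (N + 1) → C)
    (f : ∀ i : Fin N, x i.castSucc ⟶ x i.succ) (σ : Fin (n + 1) →o Fin (N + 1))
    (a b : Fin (N + 1)) (ha : a ≤ σ 0) (hb : σ (Fin.last n) ≤ b) :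
    cl rfl rfl (Cochain.eval (liftCochain T n ψ) x f σ a b ha hb) =
      ψ.eval (fun i => orb k G (x i)) (fun i => cl rfl rfl (f i)) σ a b ha hb := by
  unfold Cochain.eval
  rw [cl_comp, cl_comp, edge_cl, edge_cl]
  refine congrArg (fun g => _ ≫ g ≫ _) ?_
  refine (cl_liftCochain T hψ (fun i => x (σ i)) (fun _ => rfl) _).trans ?_
  exact congrArg (ψ fun i => orb k G (x (σ i))) (funext fun i => (edge_cl x f _).symm)

/-- The value of the lifted cochain on the translated path and the translate of its value have the
same class, because `f i` and `s f i` have the same class; injectivity of `cl` concludes. -/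
theorem liftCochain_mem {n : ℕ} {ψ : Cochain k (QuotCat k G C) n}
    (hψ : ψ ∈ (quotTrivialClass k G C T).carrier n) :
    liftCochain T n ψ ∈ (invariantCochains k G C).carrier n := by
  intro s
  refine cochain_ext k s fun x f => ?_
  refine (actCochain_act s _ x f).trans (cl_injective T (orb_smul s _) (orb_smul s _) ?_)
  rw [cl_act s rfl rfl]
  refine (cl_liftCochain T hψ x (fun _ => rfl) f).trans
    (Eq.trans ?_ (cl_liftCochain T hψ (fun i => s • x i) (fun i => orb_smul s (x i)) _).symm)
  exact congrArg (ψ _) (funext fun i => (cl_act s rfl rfl _ _ (f i)).symm)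

theorem liftCochain_d {n : ℕ} {ψ : Cochain k (QuotCat k G C) n}
    (hψ : ψ ∈ (quotTrivialClass k G C T).carrier n) :
    liftCochain T (n + 1) (d n ψ) = d n (liftCochain T n ψ) := by
  funext x
  ext f
  refine cl_injective (k := k) T rfl rfl ((cl_liftCochain T
    ((quotTrivialClass k G C T).d_mem hψ) x (fun _ => rfl) f).trans ?_)
  rw [d_apply, d_apply, map_sum]
  refine Finset.sum_congr rfl fun i _ => ?_
  rw [map_smul, cl_eval_liftCochain T hψ]

/-- Both factors have to lie in the trivial class. For general cochains, components of other
degrees, which lifting discards, can have a product that lifting keeps. -/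
theorem liftCochain_cup {m n : ℕ} {ψ : Cochain k (QuotCat k G C) m}
    {φ : Cochain k (QuotCat k G C) n} (hψ : ψ ∈ (quotTrivialClass k G C T).carrier m)
    (hφ : φ ∈ (quotTrivialClass k G C T).carrier n) :
    liftCochain T (m + n) (cup m n ψ φ) =
      cup m n (liftCochain T m ψ) (liftCochain T n φ) := by
  funext x
  ext f
  refine cl_injective (k := k) T rfl rfl ((cl_liftCochain T
    ((quotTrivialClass k G C T).cup_mem hψ hφ) x (fun _ => rfl) f).trans ?_)
  rw [cup_apply, cup_apply, cl_comp, cl_eval_liftCochain T hψ, cl_eval_liftCochain T hφ]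

theorem liftCochain_one : liftCochain T 0 one = one := by
  funext x
  ext f
  exact cl_injective (k := k) T rfl rfl ((cl_liftCochain T (quotTrivialClass k G C T).one_mem x
    (fun _ => rfl) f).trans ((galoisCovering k G C).map_id (x 0)).symm)

/-- The homomorphism `liftCochain` of differential graded algebras. -/
def liftHom : (quotTrivialClass k G C T).Hom (invariantCochains k G C) where
  map := liftCochain T
  map_mem := liftCochain_mem T
  map_d := liftCochain_d T
  map_cup := liftCochain_cup T
  map_one := liftCochain_one T

/-- The lifted cochain determines the values of `ψ` on the classes of paths of `C`, and these
determine `ψ`. -/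
theorem eq_zero_of_liftCochain_eq_zero {n : ℕ} {ψ : Cochain k (QuotCat k G C) n}
    (hψ : ψ ∈ (quotTrivialClass k G C T).carrier n) (h : liftCochain T n ψ = 0) : ψ = 0 := by
  refine quotCochain_ext T fun x f => ?_
  rw [← cl_liftCochain T hψ x (fun _ => rfl) f, h]
  exact map_zero _

end Covering

/-! ### Descending invariant cochains to the quotient category. -/

section Descent

/-- The sum of a pointwise finite family of multilinear maps. -/
def multilinearFinsum {R ι P N : Type*} [CommSemiring R] {E : ι → Type*}
    [∀ i, AddCommMonoid (E i)] [∀ i, Module R (E i)] [AddCommMonoid N] [Module R N]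
    (M : P → MultilinearMap R E N) (hM : ∀ h, (Function.support fun p => M p h).Finite) :
    MultilinearMap R E N where
  -- An infinite support would give the default value zero and spoil additivity; `hM` excludes it
  -- for every argument.
  toFun h := ∑ᶠ p, M p h
  map_update_add' h i a b := by
    simp only [MultilinearMap.map_update_add]
    exact finsum_add_distrib (hM _) (hM _)
  map_update_smul' h i c a := by
    simp only [MultilinearMap.map_update_smul]
    exact (smul_finsum' c (hM _)).symm

variable {k : Type u} [Field k] {G : Type u₁} [Group G] {C : Type w}
  [Category.{v} C] [Preadditive C] [Linear k C] [MulAction G C] [KAction k G C]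
  [FreeOnObjects G C] (T : Transversal k G C)

theorem Transversal.orb_inv_smul_rep (α : QuotCat k G C) (t : G) :
    orb k G (t⁻¹ • T.rep α) = α :=
  (orb_smul _ _).trans (T.orb_rep α)

theorem Transversal.elt_inv_smul_rep (α : QuotCat k G C) (t : G) :
    T.elt (T.orb_inv_smul_rep α t) = t⁻¹ :=
  T.elt_eq _ rfl

/-- A choice of `t 0, …, t n` with `p i = t (i + 1) * (t i)⁻¹` for all `i`. -/
def potential {n : ℕ} (p : Fin n → G) : Fin (n + 1) → G := (exists_potential p).choose

theorem potential_spec {n : ℕ} (p : Fin n → G) (i : Fin n) :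
    p i = potential p i.succ * (potential p i.castSucc)⁻¹ :=
  (exists_potential p).choose_spec.1 i

/-- The multilinear map on sequences of morphisms of the quotient category determined by the values
of `φ` on the components of degrees `p`. -/
def descendComponent {n : ℕ} (φ : Cochain k C n) (α : Fin (n + 1) → QuotCat k G C)
    (p : Fin n → G) :
    MultilinearMap k (fun i : Fin n => (α i.castSucc ⟶ α i.succ)) (α 0 ⟶ α (Fin.last n)) :=
  -- The vertices are chosen as in `exists_composable_lift`, so that lifting the argument in place
  -- `i` reads off its component of degree `p i`.
  (cl (T.orb_inv_smul_rep (α 0) (potential p 0))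
    (T.orb_inv_smul_rep (α (Fin.last n)) (potential p (Fin.last n)))).compMultilinearMap
      ((φ fun i => (potential p i)⁻¹ • T.rep (α i)).compLinearMap fun _ =>
        T.lift (T.orb_inv_smul_rep _ _) (T.orb_inv_smul_rep _ _))

/-- The argument in place `i` enters only through its component of degree `p i`. -/
theorem descendComponent_eq_zero {n : ℕ} (φ : Cochain k C n) (α : Fin (n + 1) → QuotCat k G C)
    (p : Fin n → G) (h : ∀ i : Fin n, α i.castSucc ⟶ α i.succ) (i : Fin n)
    (h0 : component T (p i) _ _ (h i) = 0) : descendComponent T φ α p h = 0 := by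
  refine (congrArg (cl _ _) (MultilinearMap.map_coord_zero
    (φ fun i => (potential p i)⁻¹ • T.rep (α i)) i ?_)).trans (map_zero _)
  refine T.lift_eq_zero _ _ ?_
  rw [T.elt_inv_smul_rep, T.elt_inv_smul_rep, inv_inv, ← potential_spec]
  exact h0

/-- A tuple `p` contributes only if each `p i` is one of the finitely many degrees occurring in `h
i`, so the contributing tuples lie in a finite product of finite sets. -/
theorem finite_support_descendComponent {n : ℕ} (φ : Cochain k C n)
    (α : Fin (n + 1) → QuotCat k G C) (h : ∀ i : Fin n, α i.castSucc ⟶ α i.succ) :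
    (Function.support fun p => descendComponent T φ α p h).Finite :=
  (Set.Finite.pi fun i => finite_component_ne_zero T (h i)).subset fun p hp i _ h0 =>
    hp (descendComponent_eq_zero T φ α p h i h0)

/-- The cochain of the quotient category induced by an invariant cochain of `C`. -/
def descend {n : ℕ} (φ : Cochain k C n) : Cochain k (QuotCat k G C) n := fun α =>
  multilinearFinsum (descendComponent T φ α) (finite_support_descendComponent T φ α)

theorem Transversal.lift_cl_heq {α β : QuotCat k G C} {x y x' y' : C} (hx : orb k G x = α)
    (hy : orb k G y = β) (hx' : orb k G x' = α) (hy' : orb k G y' = β) (s : G) (ex : s • x = x')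
    (ey : s • y = y') (f : x ⟶ y) : HEq (T.lift hx' hy' (cl hx hy f)) (act k s f) := by
  subst ex ey
  rw [← cl_act s hx hy hx' hy' f, T.lift_cl]

/-- The classes of a path are homogeneous, so a single summand survives. It evaluates `φ` on the
lift of the same classes along the vertices chosen in `descendComponent`. That path is a translate
of the given one, and by invariance `φ` takes translated values, which have the same class. -/
theorem descend_cl {n : ℕ} {φ : Cochain k C n} (hφ : φ ∈ (invariantCochains k G C).carrier n)
    {α : Fin (n + 1) → QuotCat k G C} (x : Fin (n + 1) → C) (hx : ∀ i, orb k G (x i) = α i)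
    (f : ∀ i : Fin n, x i.castSucc ⟶ x i.succ) :
    descend T φ α (fun i => cl (hx i.castSucc) (hx i.succ) (f i)) =
      cl (hx 0) (hx (Fin.last n)) (φ x f) := by
  let p : Fin n → G := fun i => (T.elt (hx i.succ))⁻¹ * T.elt (hx i.castSucc)
  refine (finsum_eq_single _ p fun q hq => ?_).trans ?_
  · obtain ⟨i, hi⟩ := Function.ne_iff.1 hq
    exact descendComponent_eq_zero T φ α q _ i
      (component_eq_zero T hi.symm (cl_mem_gradedPiece T _ _ (f i)))
  -- The chosen `potential p` and the inverses of the elements `T.elt (hx i)` have the same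
  -- successive quotients `p i`, so they differ by one constant factor. It is read off at vertex `0`
  -- and propagated along the path.
  · obtain ⟨s, hs⟩ : ∃ s, ∀ i, (potential p i)⁻¹ = s * T.elt (hx i) := by
      refine ⟨(potential p 0)⁻¹ * (T.elt (hx 0))⁻¹, fun i => ?_⟩
      induction i using Fin.induction with
      | zero => group
      | succ i ih =>
        have h : (T.elt (hx i.succ))⁻¹ * T.elt (hx i.castSucc) = _ := potential_spec p i
        have h' : potential p i.succ = (T.elt (hx i.succ))⁻¹ * T.elt (hx i.castSucc) *
          potential p i.castSucc := by rw [h]; group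
        rw [h', mul_inv_rev, ih]
        group
    have ex : ∀ i, s • x i = (potential p i)⁻¹ • T.rep (α i) := fun i => by
      rw [hs, mul_smul, T.elt_smul]
    have hinv : φ (fun i => s • x i) (fun i => act k s (f i)) = act k s (φ x f) :=
      (congrArg (fun χ : Cochain k C n => χ (fun i => s • x i) fun i => act k s (f i))
        (hφ s).symm).trans (actCochain_act s φ x f)
    refine Eq.trans ?_ (cl_act s (hx 0) (hx (Fin.last n)) ((orb_smul s _).trans (hx 0))
      ((orb_smul s _).trans (hx (Fin.last n))) (φ x f))
    rw [← hinv]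
    refine cl_heq _ _ _ _ (ex 0).symm (ex (Fin.last n)).symm ?_
    exact cochain_heq φ (funext fun i => (ex i).symm) fun i =>
      T.lift_cl_heq (hx _) (hx _) _ _ s (ex _) (ex _) (f i)

/-- Homogeneous arguments lift to a path, on which the value is the class of a morphism from its
first to its last vertex; the position of these two vertices gives the degree `t n * (t 0)⁻¹`. -/
theorem descend_mem {n : ℕ} {φ : Cochain k C n}
    (hφ : φ ∈ (invariantCochains k G C).carrier n) :
    descend T φ ∈ (quotTrivialClass k G C T).carrier n := by
  refine (mem_trivialClass_iff (quotGrading k G C T) _).2 fun α h t hh => ?_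
  obtain ⟨x, hx, f, he, hf⟩ := exists_composable_lift T α h t hh
  rw [← funext hf, descend_cl T hφ]
  have := cl_mem_gradedPiece T (hx 0) (hx (Fin.last n)) (φ x f)
  rw [he, he, inv_inv] at this
  exact this

/-- With injectivity this makes lifting bijective on cochains. Neither linearity of `descend` nor
its compatibility with the operations has to be proved, since it only serves to provide preimages.
-/
theorem liftCochain_descend {n : ℕ} {φ : Cochain k C n}
    (hφ : φ ∈ (invariantCochains k G C).carrier n) : liftCochain T n (descend T φ) = φ := by
  funext x
  ext f
  exact cl_injective (k := k) T rfl rfl ((cl_liftCochain T (descend_mem T hφ) x (fun _ => rfl)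
    f).trans (descend_cl T hφ x (fun _ => rfl) f))

/-- The cohomology of the trivial class of the quotient category is the cohomology of the invariant
cochains. -/
def trivialClassEquiv (n : ℕ) : (quotTrivialClass k G C T).Cohomology n ≃ₗ[k]
    (invariantCochains k G C).Cohomology n :=
  LinearEquiv.ofBijective ((liftHom T).onCohomology n)
    ((liftHom T).onCohomology_bijective (eq_zero_of_liftCochain_eq_zero T)
      (fun hφ => ⟨_, descend_mem T hφ, liftCochain_descend T hφ⟩) n)

/-- If the invariants functor is exact, then the cohomology of the invariant cochains consists of the
invariants of the cohomology. -/
def invariantsEquiv (h : InvariantsExact k G) (n : ℕ) :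
    (invariantCochains k G C).Cohomology n ≃ₗ[k] (cohomologyRep k G C n).invariants :=
  LinearEquiv.ofBijective (((invariantInclusion k G C).onCohomology n).codRestrict _
      invariantInclusion_onCohomology_mem)
    ⟨fun _ _ hab => invariantInclusion_onCohomology_injective h n (congrArg Subtype.val hab),
      fun c => (exists_invariantInclusion_onCohomology_eq h c.2).imp fun _ => Subtype.ext⟩

end Descent

end

end HochschildMitchell

/-! ### The two isomorphisms of graded algebras. -/

theorem mainTheorem7 (k : Type u) [Field k] (G : Type u₁) [Group G] (C : Type w) [Category.{v} C]
    [Preadditive C] [Linear k C] [MulAction G C] [HochschildMitchell.KAction k G C]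
    [HochschildMitchell.FreeOnObjects G C] (T : HochschildMitchell.Transversal k G C) :
    (∃ e : ∀ n : ℕ, (HochschildMitchell.quotTrivialClass k G C T).Cohomology n ≃ₗ[k]
        (HochschildMitchell.invariantCochains k G C).Cohomology n,
      e 0 (HochschildMitchell.quotTrivialClass k G C T).hone =
          (HochschildMitchell.invariantCochains k G C).hone ∧
        ∀ (m n : ℕ) (a : (HochschildMitchell.quotTrivialClass k G C T).Cohomology m)
          (b : (HochschildMitchell.quotTrivialClass k G C T).Cohomology n),
          e (m + n) ((HochschildMitchell.quotTrivialClass k G C T).hcup m n a b) =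
            (HochschildMitchell.invariantCochains k G C).hcup m n (e m a) (e n b)) ∧
    (HochschildMitchell.InvariantsExact k G →
      ∃ e : ∀ n : ℕ, (HochschildMitchell.quotTrivialClass k G C T).Cohomology n ≃ₗ[k]
          (HochschildMitchell.cohomologyRep k G C n).invariants,
        (e 0 (HochschildMitchell.quotTrivialClass k G C T).hone : HochschildMitchell.HH k C 0) =
            (HochschildMitchell.SubDGA.all k C).hone ∧
          ∀ (m n : ℕ) (a : (HochschildMitchell.quotTrivialClass k G C T).Cohomology m)
            (b : (HochschildMitchell.quotTrivialClass k G C T).Cohomology n),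
            (e (m + n) ((HochschildMitchell.quotTrivialClass k G C T).hcup m n a b) :
                HochschildMitchell.HH k C (m + n)) =
              (HochschildMitchell.SubDGA.all k C).hcup m n (e m a) (e n b)) := by 
  refine ⟨⟨HochschildMitchell.trivialClassEquiv T,
    (HochschildMitchell.liftHom T).onCohomology_hone,
    fun m n a b => (HochschildMitchell.liftHom T).onCohomology_hcup a b⟩, fun h =>
    -- Read in the cohomology of `C`, this composite is induced by lifting followed by the inclusion
    -- of the invariant cochains. Both are homomorphisms of differential graded algebras, which
    -- gives the unit and the products.
    ⟨fun n => HochschildMitchell.trivialClassEquiv T n ≪≫ₗ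
      HochschildMitchell.invariantsEquiv h n, ?_, fun m n a b => ?_⟩⟩
  · exact (congrArg ((HochschildMitchell.invariantInclusion k G C).onCohomology 0)
      (HochschildMitchell.liftHom T).onCohomology_hone).trans
        (HochschildMitchell.invariantInclusion k G C).onCohomology_hone
  · exact (congrArg ((HochschildMitchell.invariantInclusion k G C).onCohomology (m + n))
      ((HochschildMitchell.liftHom T).onCohomology_hcup a b)).trans
        ((HochschildMitchell.invariantInclusion k G C).onCohomology_hcup _ _)
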